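/- Let $\mathbb K=\mathbb C(q^{1/2})$. For $n\geqslant 1$ let $N=2n+1$ (type $B$) or $N=2n$ (type $D$), $i'=N+1-i$, $\xi=q^{2-N}$, and let $(\overline 1,\dots,\overline N)=\big(n-\tfrac12,\dots,\tfrac12,0,-\tfrac12,\dots,-n+\tfrac12\big)$ in type $B$ and $(\overline 1,\dots,\overline N)=(n-1,\dots,1,0,0,-1,\dots,-n+1)$ in type $D$. With matrix units $e_{ij}\in\operatorname{End}\mathbb K^N$ put $P=\sum_{i,j} e_{ij}\otimes e_{ji}$, $Q=\sum_{i,j} q^{\bar\imath-\bar\jmath}e_{i'j'}\otimes e_{ij}$, $$R=q\sum_{i\ne i'}e_{ii}\otimes e_{ii}+\sum_{i=i'}e_{ii}\otimes e_{ii}+\sum_{i\neq j,j'}e_{ii}\otimes e_{jj}+q^{-1}\sum_{i\neq i'}e_{ii}\otimes e_{i'i'}+(q-q^{-1})\sum_{i<j}e_{ij}\otimes e_{ji}-(q-q^{-1})\sum_{i>j}q^{\bar\imath-\bar\jmath}e_{i'j'}\otimes e_{ij},$$ $$\overline R^{[n]}(u)=\frac{u-1}{uq-q^{-1}}R+\frac{q-q^{-1}}{uq-q^{-1}}P-\frac{(q-q^{-1})(u-1)\xi}{(uq-q^{-1})(u-\xi)}Q.$$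 Fix the type ($B$ or $D$) and a sign $\sigma\in\{+,-\}$. Let $U(\overline R^{[n]})$ be the unital associative $\mathbb K$-algebra generated by an invertible central element $q^{c/2}$ and elements $\ell^{\pm}_{ij}[\mp r]$ ($1\leqslant i,j\leqslant N$, $r\geqslant 0$) subject to $\ell^{\sigma}_{ij}[0]=\ell^{-\sigma}_{ji}[0]=0$ for $i>j$, $\ell^{+}_{ii}[0]\,\ell^{-}_{ii}[0]=\ell^{-}_{ii}[0]\,\ell^{+}_{ii}[0]=1$, and $$\overline R^{[n]}(u/v)\mathcal L^{\pm}_1(u)\mathcal L^{\pm}_2(v)=\mathcal L^{\pm}_2(v)\mathcal L^{\pm}_1(u)\overline R^{[n]}(u/v),$$ $$\overline R^{[n]}(uq^{c}/v)\mathcal L^{+}_1(u)\mathcal L^{-}_2(v)=\mathcal L^{-}_2(v)\mathcal L^{+}_1(u)\overline R^{[n]}(uq^{-c}/v),$$ where $\ell^{\pm}_{ij}(u)=\sum_{r\geqslant0}\ell^{\pm}_{ij}[\mp r]u^{\pm r}$, $\mathcal L^{\pm}(u)=\sum_{i,j}\ell^{\pm}_{ij}(u)\otimes e_{ij}$, the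 subscripts $1,2$ indicate the copy of $\operatorname{End}\mathbb K^N$ in which $e_{ij}$ is placed, and the rational functions $\overline R^{[n]}$ are expanded in nonnegative powers of $u/v$. For a square matrix $A=[a_{ij}]$ over a ring with $1$, let $A^{ij}$ be $A$ with row $i$ and column $j$ deleted. If $A^{ij}$ is invertible, the quasideterminant is $|A|_{ij}=a_{ij}-r_i^{j}(A^{ij})^{-1}c_j^{i}$, where $r_i^j$ is the $i$-th row of $A$ without $a_{ij}$ and $c_j^i$ is the $j$-th column of $A$ without $a_{ij}$; it is denoted by boxing the entry $a_{ij}$. **Theorem.** (1) Let $m,n$ be integers with $1\leqslant m\leqslant n-1$, and label the generators of $U(\overline R^{[n-m]})$ (of the same type and the same $\sigma$) by the indices $m+1\leqslant i,j\leqslant (m+1)'=N-m$. The matrices $[\ell^{\pm}_{ab}(u)]_{1\leqslant a,b\leqslant m}$ over $U(\overline R^{[n]})[[u^{\pm1}]]$ are invertible, and the mappings $q^{\pm c/2}\mapsto q^{\pm c/2}$, $$\ell^{\pm}_{ij}(u)\mapsto\left|\begin{matrix}\ell^{\pm}_{11}(u)&\dots&\ell^{\pm}_{1m}(u)&\ell^{\pm}_{1j}(u)\\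 \dots&\dots&\dots&\dots\\ \ell^{\pm}_{m1}(u)&\dots&\ell^{\pm}_{mm}(u)&\ell^{\pm}_{mj}(u)\\ \ell^{\pm}_{i1}(u)&\dots&\ell^{\pm}_{im}(u)&\boxed{\ell^{\pm}_{ij}(u)}\end{matrix}\right|,\qquad m+1\leqslant i,j\leqslant(m+1)',$$ define a (unique) homomorphism of unital $\mathbb K$-algebras $\psi^{(n)}_m\colon U(\overline R^{[n-m]})\to U(\overline R^{[n]})$. (For $m=1$ the image of $\ell^{\pm}_{ij}(u)$ is $\ell^{\pm}_{ij}(u)-\ell^{\pm}_{i1}(u)\,\ell^{\pm}_{11}(u)^{-1}\,\ell^{\pm}_{1j}(u)$.) (2) For all $l,m\geqslant1$ with $l+m\leqslant n-1$ one has $\psi^{(n)}_l\circ\psi^{(n-l)}_m=\psi^{(n)}_{l+m}$. -/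

import Mathlib

noncomputable section

namespace QAff

open scoped Kronecker PowerSeries

/-- The base field `ℂ(q^{1/2})`. -/
abbrev K : Type := RatFunc ℂ

/-- The variable `q^{1/2}`. -/
def qh : K := RatFunc.X

def q : K := qh ^ 2

/-- The two series of orthogonal Lie algebras: `𝔬_{2n+1}` (type `B_n`) and `𝔬_{2n}` (type `D_n`). -/
inductive OType
  | B
  | D

/-- A sign, `+` or `-`. -/
inductive Sgn
  | plus
  | minus

def Sgn.neg : Sgn → Sgn
  | .plus => .minus
  | .minus => .plus

/-- `N = 2n+1` in type `B` and `N = 2n` in type `D`. -/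
def dim : OType → ℕ → ℕ
  | .B, n => 2 * n + 1
  | .D, n => 2 * n

/-- The indices `1, …, N` are represented by `0, …, N-1`; the involution `i ↦ i' = N + 1 - i`
becomes `Fin.rev`, and `bar2 τ n i` is twice the barred symbol of the index:
`(n - 1/2, …, 1/2, 0, -1/2, …, -n + 1/2)` in type `B`, `(n - 1, …, 0, 0, …, -n + 1)` in type `D`. -/
def bar2 : (τ : OType) → (n : ℕ) → Fin (dim τ n) → ℤ
  | .B, n, i =>
      if (i : ℕ) < n then 2 * n - 1 - 2 * (i : ℕ)
      else if (i : ℕ) = n then 0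
      else 2 * n + 1 - 2 * (i : ℕ)
  | .D, n, i =>
      if (i : ℕ) < n then 2 * (n - 1 - (i : ℕ)) else 2 * (n - (i : ℕ))

/-- `ξ = q^{2-N}`. -/
def xi (τ : OType) (n : ℕ) : K := q ^ (2 - (dim τ n : ℤ))

section RMatrix

variable (τ : OType) (n : ℕ)

/-- Elements of `End(K^N) ⊗ End(K^N)` are matrices indexed by pairs: `a ⊗ b` is the Kronecker
product `a ⊗ₖ b`. -/
abbrev M2 (A : Type) : Type :=
  Matrix (Fin (dim τ n) × Fin (dim τ n)) (Fin (dim τ n) × Fin (dim τ n)) A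

/-- The matrix unit `e_{ij}`. -/
abbrev e (i j : Fin (dim τ n)) : Matrix (Fin (dim τ n)) (Fin (dim τ n)) K := Matrix.single i j 1

def P : M2 τ n K := ∑ i, ∑ j, e τ n i j ⊗ₖ e τ n j i

def Q : M2 τ n K :=
  ∑ i, ∑ j, qh ^ (bar2 τ n i - bar2 τ n j) • (e τ n i.rev j.rev ⊗ₖ e τ n i j)

/-- The constant matrix `R`. An index with `i = i'` exists only in type `B` (the middle index), so
the second sum is `e_{n+1,n+1} ⊗ e_{n+1,n+1}` in type `B` and is empty in type `D`. -/
def R : M2 τ n K :=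
  q • (∑ i with i ≠ i.rev, e τ n i i ⊗ₖ e τ n i i)
  + (∑ i with i = i.rev, e τ n i i ⊗ₖ e τ n i i)
  + (∑ i, ∑ j with i ≠ j ∧ i ≠ j.rev, e τ n i i ⊗ₖ e τ n j j)
  + q⁻¹ • (∑ i with i ≠ i.rev, e τ n i i ⊗ₖ e τ n i.rev i.rev)
  + (q - q⁻¹) • (∑ i, ∑ j with i < j, e τ n i j ⊗ₖ e τ n j i)
  - (q - q⁻¹) • (∑ i, ∑ j with j < i,
      qh ^ (bar2 τ n i - bar2 τ n j) • (e τ n i.rev j.rev ⊗ₖ e τ n i j))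

/-- The `R`-matrix
`R̄(x) = (x-1)/(qx-q⁻¹) R + (q-q⁻¹)/(qx-q⁻¹) P - (q-q⁻¹)(x-1)ξ/((qx-q⁻¹)(x-ξ)) Q`,
its entries being expanded as power series in `x` (both denominators are nonzero at `x = 0`). -/
def Rbar : M2 τ n K⟦X⟧ :=
  ((PowerSeries.X - 1) * (PowerSeries.C q * PowerSeries.X - PowerSeries.C q⁻¹)⁻¹) •
      (R τ n).map PowerSeries.C
  + (PowerSeries.C (q - q⁻¹) * (PowerSeries.C q * PowerSeries.X - PowerSeries.C q⁻¹)⁻¹) •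
      (P τ n).map PowerSeries.C
  - (PowerSeries.C ((q - q⁻¹) * xi τ n) * (PowerSeries.X - 1)
      * (PowerSeries.C q * PowerSeries.X - PowerSeries.C q⁻¹)⁻¹
      * (PowerSeries.X - PowerSeries.C (xi τ n))⁻¹) • (Q τ n).map PowerSeries.C

/-- The coefficient of `x^k` in `R̄(x)`. -/
def RbarCoeff (k : ℕ) : M2 τ n K := (Rbar τ n).map (PowerSeries.coeff k)

end RMatrix

section RLL

variable {τ : OType} {n : ℕ} {A : Type} [Ring A] [Algebra K A]

/-- For a family `l ε i j m` standing for `ℓ^±_{ij}[∓m]`, the coefficient of `u^r` (`r ∈ ℤ`) in the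
matrix `𝓛^±(u)` with the entries `ℓ^±_{ij}(u) = ∑_{m ≥ 0} ℓ^±_{ij}[∓m] u^{±m}`. -/
def Lcoeff (l : Sgn → Fin (dim τ n) → Fin (dim τ n) → ℕ → A) :
    Sgn → ℤ → Matrix (Fin (dim τ n)) (Fin (dim τ n)) A
  | .plus, r => if 0 ≤ r then Matrix.of fun i j => l .plus i j r.toNat else 0
  | .minus, r => if r ≤ 0 then Matrix.of fun i j => l .minus i j (-r).toNat else 0

/-- The coefficient of `u^r v^s` in `R̄(ut/v) 𝓛₁^{ε₁}(u) 𝓛₂^{ε₂}(v)`, where `R̄(ut/v)` is expanded in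
powers of `u/v`. For `(ε₁, ε₂) = (+,+), (-,-), (+,-)` all terms with `k > |r| + |s|` vanish. -/
def rllLeft (l : Sgn → Fin (dim τ n) → Fin (dim τ n) → ℕ → A) (t : A) (ε₁ ε₂ : Sgn) (r s : ℤ) :
    M2 τ n A :=
  ∑ k ∈ Finset.range (r.natAbs + s.natAbs + 1),
    t ^ k • ((RbarCoeff τ n k).map (algebraMap K A)
      * (Lcoeff l ε₁ (r - k) ⊗ₖ (1 : Matrix (Fin (dim τ n)) (Fin (dim τ n)) A))
      * ((1 : Matrix (Fin (dim τ n)) (Fin (dim τ n)) A) ⊗ₖ Lcoeff l ε₂ (s + k)))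

/-- The coefficient of `u^r v^s` in `𝓛₂^{ε₂}(v) 𝓛₁^{ε₁}(u) R̄(ut/v)`, expanded in the same way. -/
def rllRight (l : Sgn → Fin (dim τ n) → Fin (dim τ n) → ℕ → A) (t : A) (ε₁ ε₂ : Sgn) (r s : ℤ) :
    M2 τ n A :=
  ∑ k ∈ Finset.range (r.natAbs + s.natAbs + 1),
    t ^ k • (((1 : Matrix (Fin (dim τ n)) (Fin (dim τ n)) A) ⊗ₖ Lcoeff l ε₂ (s + k))
      * (Lcoeff l ε₁ (r - k) ⊗ₖ (1 : Matrix (Fin (dim τ n)) (Fin (dim τ n)) A))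
      * (RbarCoeff τ n k).map (algebraMap K A))

end RLL

/-- Generators: `q^{c/2}`, its inverse, and `l ε i j m`, which stands for `ℓ^±_{ij}[∓m]`. -/
inductive Gen (N : ℕ) : Type
  | qc : Gen N
  | qcInv : Gen N
  | l (ε : Sgn) (i j : Fin N) (m : ℕ) : Gen N

/-- The defining relations. The sign `σ` fixes the triangularity convention for the zero modes:
`ℓ^σ_{ij}[0] = ℓ^{-σ}_{ji}[0] = 0` for `i > j`. -/
inductive Rel (τ : OType) (σ : Sgn) (n : ℕ) :
    FreeAlgebra K (Gen (dim τ n)) → FreeAlgebra K (Gen (dim τ n)) → Prop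
  | qc_mul : Rel τ σ n (FreeAlgebra.ι K .qc * FreeAlgebra.ι K .qcInv) 1
  | qcInv_mul : Rel τ σ n (FreeAlgebra.ι K .qcInv * FreeAlgebra.ι K .qc) 1
  | qc_central (g : Gen (dim τ n)) :
      Rel τ σ n (FreeAlgebra.ι K .qc * FreeAlgebra.ι K g) (FreeAlgebra.ι K g * FreeAlgebra.ι K .qc)
  | zero_upper (i j : Fin (dim τ n)) (h : j < i) : Rel τ σ n (FreeAlgebra.ι K (.l σ i j 0)) 0
  | zero_lower (i j : Fin (dim τ n)) (h : j < i) : Rel τ σ n (FreeAlgebra.ι K (.l σ.neg j i 0)) 0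
  | diag (ε : Sgn) (i : Fin (dim τ n)) :
      Rel τ σ n (FreeAlgebra.ι K (.l ε i i 0) * FreeAlgebra.ι K (.l ε.neg i i 0)) 1
  | rll_same (ε : Sgn) (r s : ℤ) (a b : Fin (dim τ n) × Fin (dim τ n)) :
      Rel τ σ n
        (rllLeft (fun ε i j m => FreeAlgebra.ι K (.l ε i j m)) 1 ε ε r s a b)
        (rllRight (fun ε i j m => FreeAlgebra.ι K (.l ε i j m)) 1 ε ε r s a b)
  | rll_mixed (r s : ℤ) (a b : Fin (dim τ n) × Fin (dim τ n)) :
      Rel τ σ n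
        (rllLeft (fun ε i j m => FreeAlgebra.ι K (.l ε i j m))
          (FreeAlgebra.ι K .qc ^ 2) .plus .minus r s a b)
        (rllRight (fun ε i j m => FreeAlgebra.ι K (.l ε i j m))
          (FreeAlgebra.ι K .qcInv ^ 2) .plus .minus r s a b)

/-- The algebra `U(R̄^{[n]})`. -/
abbrev U (τ : OType) (σ : Sgn) (n : ℕ) : Type := RingQuot (Rel τ σ n)

/-- The image of a generator in `U(R̄^{[n]})`. -/
def U.gen (τ : OType) (σ : Sgn) (n : ℕ) (g : Gen (dim τ n)) : U τ σ n :=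
  RingQuot.mkAlgHom K (Rel τ σ n) (FreeAlgebra.ι K g)

/-- The matrix `𝓛^±(u)`, its entries `ℓ^±_{ij}(u)` being power series in `u^{±1}`. -/
def Lser (τ : OType) (σ : Sgn) (n : ℕ) (ε : Sgn) :
    Matrix (Fin (dim τ n)) (Fin (dim τ n)) (U τ σ n)⟦X⟧ :=
  Matrix.of fun i j => PowerSeries.mk fun m => U.gen τ σ n (.l ε i j m)

/-- The quasideterminant `|A|_{ij} = a_{ij} - r_i^j (A^{ij})⁻¹ c_j^i` of a square matrix over a ring,
where `A^{ij}` is `A` without row `i` and column `j`; meaningful when `A^{ij}` is invertible. -/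
def quasidet {S : Type} [Ring S] {m : ℕ} (A : Matrix (Fin (m + 1)) (Fin (m + 1)) S)
    (i j : Fin (m + 1)) : S :=
  A i j - ∑ a, ∑ b, A i (j.succAbove a) *
    Ring.inverse (A.submatrix i.succAbove j.succAbove) a b * A (i.succAbove b) j

theorem dim_eq (τ : OType) {m n p : ℕ} (h : p + m = n) : dim τ n = dim τ p + 2 * m := by
  subst h
  cases τ <;> simp only [dim] <;> ring

/-- The inclusion of the index set `{1, …, m}` into `{1, …, N}`, for `n = p + m`. -/
def firstIdx (τ : OType) {m n p : ℕ} (h : p + m = n) (a : Fin m) : Fin (dim τ n) :=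
  ⟨a, by have := dim_eq τ h; omega⟩

/-- The labelling of the generators of `U(R̄^{[p]})`, `p = n - m`, by the indices
`m+1, …, (m+1)'` of `U(R̄^{[n]})`. -/
def shiftIdx (τ : OType) {m n p : ℕ} (h : p + m = n) (i : Fin (dim τ p)) : Fin (dim τ n) :=
  ⟨m + i, by have := dim_eq τ h; omega⟩

/-- The index sequence `1, …, m, i`, where `i` is one of `m+1, …, (m+1)'`. -/
def bordered (τ : OType) {m n p : ℕ} (h : p + m = n) (i : Fin (dim τ p)) :
    Fin (m + 1) → Fin (dim τ n) :=
  Fin.snoc (α := fun _ => Fin (dim τ n)) (firstIdx τ h) (shiftIdx τ h i)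

/-- `ψ : U(R̄^{[n-m]}) → U(R̄^{[n]})` is given on the generators by `q^{±c/2} ↦ q^{±c/2}` and by the
quasideterminants of the submatrices of `𝓛^±(u)` with the rows `1, …, m, i` and the columns
`1, …, m, j`, the boxed entry being the last one. -/
structure IsReduction {τ : OType} {σ : Sgn} {m n p : ℕ} (h : p + m = n)
    (ψ : U τ σ p →ₐ[K] U τ σ n) : Prop where
  map_qc : ψ (U.gen τ σ p .qc) = U.gen τ σ n .qc
  map_qcInv : ψ (U.gen τ σ p .qcInv) = U.gen τ σ n .qcInv
  map_l (ε : Sgn) (i j : Fin (dim τ p)) :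
    PowerSeries.map (ψ : U τ σ p →+* U τ σ n) (Lser τ σ p ε i j) =
      quasidet ((Lser τ σ n ε).submatrix (bordered τ h i) (bordered τ h j))
        (Fin.last m) (Fin.last m)

end QAff

end

/-! Everything reduces to the case `m = 1`. Gaussian elimination of the first `l` rows and then of
the next `m` gives the same result as eliminating all `l + m` at once (`IsReduction.comp`); this is
part (2) and also the induction step for existence. Uniqueness holds because the images of all
generators are prescribed.

For `m = 1`, the Schur complements of the corner entry must satisfy the relations of rank `p = n -
1`. Grade `V ⊗ V` by giving the first basis vector (top) degree `1`, the last (bot) degree `-1` and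
the others (mid) degree `0`; `R̄` preserves the degree. Two facts carry the proof. First, the
`R`-matrix of rank `p` is the Schur complement of the one of rank `p + 1` with respect to its
diagonal entry at (top, bot) (`Rbar_schur`). Second, a relation `a T₁T'₂ = T'₂T₁ b` with graded `a`,
`b` passes to Schur complements (`schur_exchange`). Column and row vectors produced by elimination
remove from `T₁T'₂` and `T'₂T₁` all positive degrees and the position (bot, top). What remains is a
2×2 block identity `a L = L' b`, with `L` upper and `L'` lower triangular and with products of Schur
complements of `T`, `T'` in the last diagonal blocks; then the Schur complements of `a` and `b`
intertwine these blocks (`schur_of_triangular`).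

To work in a single ring, the relations in `u` and `v` are rewritten as power series identities over
`A⟦x⟧⟦y⟧`, with monomials `x`, `y` in `u`, `v` chosen so that only nonnegative exponents occur
(`rll_iff`). The required inverses exist because the zero modes are triangular with invertible
diagonal (`IsRLLFamily.isUnit_of_constantCoeff`). -/

noncomputable section

namespace QAff

open scoped Kronecker PowerSeries

/-! ### Matrix entries of `R`, `P`, `Q` and the grading preserved by `R̄` -/

section Entries

variable (τ : OType) (n : ℕ)

theorem sum_diag_apply (p : Fin (dim τ n) → Prop) [DecidablePred p]
    (f : Fin (dim τ n) → Fin (dim τ n)) (a b c d : Fin (dim τ n)) :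
    (∑ i with p i, e τ n i i ⊗ₖ e τ n (f i) (f i)) (a, b) (c, d) =
      if a = c ∧ b = d ∧ b = f a ∧ p a then 1 else 0 := by
  simp only [Matrix.sum_apply, Matrix.kroneckerMap_apply, Matrix.single_apply]
  simp only [Finset.sum_filter]
  rw [Finset.sum_eq_single a]
  · split_ifs <;> grind
  all_goals simp +contextual

theorem sum_diag₂_apply (p : Fin (dim τ n) → Fin (dim τ n) → Prop) [∀ i, DecidablePred (p i)]
    (a b c d : Fin (dim τ n)) :
    (∑ i, ∑ j with p i j, e τ n i i ⊗ₖ e τ n j j) (a, b) (c, d) =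
      if a = c ∧ b = d ∧ p a b then 1 else 0 := by
  simp only [Matrix.sum_apply, Matrix.kroneckerMap_apply, Matrix.single_apply]
  simp only [Finset.sum_filter]
  rw [Finset.sum_eq_single a, Finset.sum_eq_single b]
  · split_ifs <;> grind
  all_goals simp +contextual

theorem sum_flip_apply (p : Fin (dim τ n) → Fin (dim τ n) → Prop) [∀ i, DecidablePred (p i)]
    (a b c d : Fin (dim τ n)) :
    (∑ i, ∑ j with p i j, e τ n i j ⊗ₖ e τ n j i) (a, b) (c, d) =
      if a = d ∧ b = c ∧ p a b then 1 else 0 := by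
  simp only [Matrix.sum_apply, Matrix.kroneckerMap_apply, Matrix.single_apply]
  simp only [Finset.sum_filter]
  rw [Finset.sum_eq_single a, Finset.sum_eq_single b]
  · split_ifs <;> grind
  all_goals simp +contextual

theorem sum_rev_apply (p : Fin (dim τ n) → Fin (dim τ n) → Prop) [∀ i, DecidablePred (p i)]
    (w : Fin (dim τ n) → Fin (dim τ n) → K) (a b c d : Fin (dim τ n)) :
    (∑ i, ∑ j with p i j, w i j • (e τ n i.rev j.rev ⊗ₖ e τ n i j)) (a, b) (c, d) =
      if a = b.rev ∧ c = d.rev ∧ p b d then w b d else 0 := by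
  simp only [Matrix.sum_apply, Matrix.smul_apply, Matrix.kroneckerMap_apply, Matrix.single_apply]
  simp only [Finset.sum_filter]
  rw [Finset.sum_eq_single b, Finset.sum_eq_single d]
  · split_ifs <;> grind [smul_eq_mul, mul_one, mul_zero, smul_zero]
  all_goals simp +contextual

theorem P_apply (a b c d : Fin (dim τ n)) :
    P τ n (a, b) (c, d) = if a = d ∧ b = c then 1 else 0 := by
  have := sum_flip_apply τ n (fun _ _ => True) a b c d
  simpa [P] using this

theorem Q_apply (a b c d : Fin (dim τ n)) :
    Q τ n (a, b) (c, d) =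
      if a = b.rev ∧ c = d.rev then qh ^ (bar2 τ n b - bar2 τ n d) else 0 := by
  have := sum_rev_apply τ n (fun _ _ => True) (fun i j => qh ^ (bar2 τ n i - bar2 τ n j)) a b c d
  simpa [Q] using this

theorem R_apply (a b c d : Fin (dim τ n)) :
    R τ n (a, b) (c, d) =
      (if a = c ∧ b = d then
        (if a = b then (if a = a.rev then 1 else q) else if b = a.rev then q⁻¹ else 1) else 0)
      + (if a = d ∧ b = c ∧ a < b then q - q⁻¹ else 0)
      - (if a = b.rev ∧ c = d.rev ∧ d < b then
          (q - q⁻¹) * qh ^ (bar2 τ n b - bar2 τ n d) else 0) := by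
  simp only [R, Matrix.add_apply, Matrix.sub_apply, Matrix.smul_apply]
  rw [sum_diag_apply τ n _ (fun i => i), sum_diag_apply τ n _ (fun i => i), sum_diag₂_apply,
    sum_diag_apply τ n _ Fin.rev, sum_flip_apply, sum_rev_apply]
  simp only [smul_eq_mul, mul_ite, mul_zero, mul_one]
  congr 2
  have hr : ∀ i j : Fin (dim τ n), i = j.rev ↔ j = i.rev := fun i j => by
    constructor <;> rintro rfl <;> simp
  have := hr a b
  split_ifs <;> grind

/-- The degree of the basis vectors with respect to the first fundamental coweight. -/
def deg (i : Fin (dim τ n)) : ℤ :=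
  (if (i : ℕ) = 0 then 1 else 0) - (if (i.rev : ℕ) = 0 then 1 else 0)

theorem deg_rev (i : Fin (dim τ n)) : deg τ n i.rev = - deg τ n i := by
  simp [deg]

theorem Rbar_apply (i j : Fin (dim τ n) × Fin (dim τ n)) :
    Rbar τ n i j =
  ((PowerSeries.X - 1) * (PowerSeries.C q * PowerSeries.X - PowerSeries.C q⁻¹)⁻¹) *
      PowerSeries.C (R τ n i j)
  + (PowerSeries.C (q - q⁻¹) * (PowerSeries.C q * PowerSeries.X - PowerSeries.C q⁻¹)⁻¹) *
      PowerSeries.C (P τ n i j)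
  - (PowerSeries.C ((q - q⁻¹) * xi τ n) * (PowerSeries.X - 1)
      * (PowerSeries.C q * PowerSeries.X - PowerSeries.C q⁻¹)⁻¹
      * (PowerSeries.X - PowerSeries.C (xi τ n))⁻¹) * PowerSeries.C (Q τ n i j) := by
  simp [Rbar, Matrix.sub_apply, Matrix.add_apply]

/-- Every matrix unit in `R`, `P`, `Q` either permutes the two labels or sends a pair `(d', d)` to a
pair `(b', b)`, and such pairs have total degree zero. -/
theorem Rbar_deg (a b c d : Fin (dim τ n))
    (h : deg τ n a + deg τ n b ≠ deg τ n c + deg τ n d) : Rbar τ n (a, b) (c, d) = 0 := by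
  have h1 : ¬ (a = c ∧ b = d) := by rintro ⟨rfl, rfl⟩; simp at h
  have h2 : ¬ (a = d ∧ b = c) := by rintro ⟨rfl, rfl⟩; simp [add_comm] at h
  have h3 : ¬ (a = b.rev ∧ c = d.rev) := by rintro ⟨rfl, rfl⟩; simp [deg_rev] at h
  rw [Rbar_apply, R_apply, P_apply, Q_apply]
  simp only [← and_assoc, h1, h2, h3]
  simp

theorem qh_ne_zero : qh ≠ 0 := RatFunc.X_ne_zero

theorem q_ne_zero : q ≠ 0 := pow_ne_zero _ qh_ne_zero

theorem xi_ne_zero : xi τ n ≠ 0 := zpow_ne_zero _ q_ne_zero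

end Entries

/-! ### The `R`-matrix of rank `p` as a Schur complement in rank `p + 1` -/

section Reduction

variable (τ : OType) (p : ℕ)

theorem dim_succ : dim τ (p + 1) = dim τ p + 2 := by simpa using dim_eq τ (rfl : p + 1 = p + 1)

def top : Fin (dim τ (p + 1)) := ⟨0, by rw [dim_succ]; omega⟩

def bot : Fin (dim τ (p + 1)) := ⟨dim τ p + 1, by rw [dim_succ]; omega⟩

def mid (i : Fin (dim τ p)) : Fin (dim τ (p + 1)) := ⟨i + 1, by rw [dim_succ]; omega⟩

variable {τ p}

@[simp] theorem mid_inj {i j : Fin (dim τ p)} : mid τ p i = mid τ p j ↔ i = j := by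
  simp [mid, Fin.ext_iff]

@[simp] theorem mid_lt {i j : Fin (dim τ p)} : mid τ p i < mid τ p j ↔ i < j := by
  rw [Fin.lt_def, Fin.lt_def]; simp [mid]

theorem mid_rev (i : Fin (dim τ p)) : (mid τ p i).rev = mid τ p i.rev := by
  have := dim_succ τ p
  simp only [mid, Fin.ext_iff, Fin.val_rev]; omega

@[simp] theorem top_rev : (top τ p).rev = bot τ p := by
  have := dim_succ τ p
  simp only [top, bot, Fin.ext_iff, Fin.val_rev]; omega

@[simp] theorem bot_rev : (bot τ p).rev = top τ p := by
  rw [← top_rev, Fin.rev_rev]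

@[simp] theorem mid_ne_top (i : Fin (dim τ p)) : mid τ p i ≠ top τ p := by
  simp [mid, top, Fin.ext_iff]

@[simp] theorem mid_ne_bot (i : Fin (dim τ p)) : mid τ p i ≠ bot τ p := by
  simp only [mid, bot, Fin.ext_iff, ne_eq]; omega

@[simp] theorem top_ne_bot : top τ p ≠ bot τ p := by
  simp [top, bot, Fin.ext_iff]

theorem mid_lt_bot (i : Fin (dim τ p)) : mid τ p i < bot τ p := by
  rw [Fin.lt_def]; simp only [mid, bot]; omega

theorem bar2_mid (i : Fin (dim τ p)) : bar2 τ (p + 1) (mid τ p i) = bar2 τ p i := by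
  cases τ <;> simp only [bar2, mid] <;> push_cast <;> split_ifs <;> omega

@[simp] theorem deg_mid (i : Fin (dim τ p)) : deg τ (p + 1) (mid τ p i) = 0 := by
  simp [deg, mid_rev]; simp [mid]

@[simp] theorem deg_top : deg τ (p + 1) (top τ p) = 1 := by
  simp [deg]; simp [top, bot]

@[simp] theorem deg_bot : deg τ (p + 1) (bot τ p) = -1 := by
  rw [← top_rev, deg_rev, deg_top]

theorem sum_top_mid_bot {M : Type*} [AddCommMonoid M] (f : Fin (dim τ (p + 1)) → M) :
    ∑ i, f i = f (top τ p) + ∑ i, f (mid τ p i) + f (bot τ p) := by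
  rw [← (finCongr (dim_succ τ p).symm).sum_comp, Fin.sum_univ_castSucc, Fin.sum_univ_succ]
  rfl

theorem xi_succ : xi τ p = q ^ 2 * xi τ (p + 1) := by
  rw [xi, xi, dim_succ, ← zpow_natCast, ← zpow_add₀ q_ne_zero]
  congr 1; push_cast; ring

theorem R_mid (a b c d : Fin (dim τ p)) :
    R τ (p + 1) (mid τ p a, mid τ p b) (mid τ p c, mid τ p d) = R τ p (a, b) (c, d) := by
  simp only [R_apply, mid_rev, mid_inj, mid_lt, bar2_mid]

theorem P_mid (a b c d : Fin (dim τ p)) :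
    P τ (p + 1) (mid τ p a, mid τ p b) (mid τ p c, mid τ p d) = P τ p (a, b) (c, d) := by
  simp only [P_apply, mid_inj]

theorem Q_mid (a b c d : Fin (dim τ p)) :
    Q τ (p + 1) (mid τ p a, mid τ p b) (mid τ p c, mid τ p d) = Q τ p (a, b) (c, d) := by
  simp only [Q_apply, mid_rev, mid_inj, bar2_mid]

variable (τ p)

/-- The pivot entry of `R̄` together with its inverse. -/
theorem Rbar_pivot_inverse :
    Rbar τ (p + 1) (top τ p, bot τ p) (top τ p, bot τ p) *
      ((PowerSeries.C q * PowerSeries.X - PowerSeries.C q⁻¹) *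
        (PowerSeries.X - PowerSeries.C (xi τ (p + 1))) * PowerSeries.C q *
        (PowerSeries.X - 1)⁻¹ * (PowerSeries.X - PowerSeries.C (xi τ p))⁻¹) = 1 := by
  have hq := q_ne_zero
  have hξ := xi_ne_zero τ (p + 1)
  have e1 := PowerSeries.mul_inv_cancel (PowerSeries.C q * PowerSeries.X - PowerSeries.C q⁻¹)
    (by simp [hq])
  have e2 := PowerSeries.mul_inv_cancel (PowerSeries.X - PowerSeries.C (xi τ (p + 1)))
    (by simp [hξ])
  have e3 := PowerSeries.mul_inv_cancel (PowerSeries.X - PowerSeries.C (xi τ p))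
    (by simp [xi_ne_zero])
  have e4 := PowerSeries.mul_inv_cancel (PowerSeries.X - 1 : K⟦X⟧) (by simp)
  have hC : PowerSeries.C q * PowerSeries.C q⁻¹ = 1 := by rw [← map_mul, mul_inv_cancel₀ hq, map_one]
  rw [Rbar_apply, R_apply, P_apply, Q_apply]
  simp only [top_ne_bot, top_ne_bot.symm, top_rev, bot_rev, lt_irrefl, sub_self, zpow_zero, and_self,
    if_true, if_false, and_false, map_one, map_zero, mul_one, mul_zero, false_and, add_zero, sub_zero]
  rw [xi_succ (τ := τ) (p := p)] at e3 ⊢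
  simp only [map_mul, map_sub, map_pow] at *
  -- Power series do not form a field, so each inverse becomes a letter subject to the relation that
  -- its product with the denominator is `1`.
  generalize (PowerSeries.C q * PowerSeries.X - PowerSeries.C q⁻¹)⁻¹ = g at *
  generalize (PowerSeries.X - PowerSeries.C (xi τ (p + 1)))⁻¹ = h at *
  generalize (PowerSeries.X - PowerSeries.C q ^ 2 * PowerSeries.C (xi τ (p + 1)))⁻¹ = h' at *
  generalize (PowerSeries.X - 1 : K⟦X⟧)⁻¹ = f at *
  generalize PowerSeries.C q⁻¹ = q' at *
  generalize PowerSeries.C q = Q at *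
  generalize PowerSeries.C (xi τ (p + 1)) = ξ at *
  generalize (PowerSeries.X : K⟦X⟧) = x at *
  calc _ = ((x - 1) * f) * ((Q * x - q') * g) *
        (q' * (x - ξ) - (Q - q') * ξ * ((x - ξ) * h)) * Q * h' := by ring
    _ = 1 := by
      -- The remaining numerator of the pivot is `x - q²ξ = x - ξ_p`, which `h'` inverts.
      rw [e4, e1, e2]
      linear_combination e3 + x * h' * hC

/-- On the middle indices the two ranks differ only in the coefficient of `Q`, through `ξ_p = q²
ξ_{p+1}`. The correction through the pivot is a multiple of the same `Q` and makes up the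
difference. -/
theorem Rbar_schur (a b c d : Fin (dim τ p)) (r : K⟦X⟧)
    (hr : Rbar τ (p + 1) (top τ p, bot τ p) (top τ p, bot τ p) * r = 1) :
    Rbar τ p (a, b) (c, d) =
      Rbar τ (p + 1) (mid τ p a, mid τ p b) (mid τ p c, mid τ p d)
      - Rbar τ (p + 1) (mid τ p a, mid τ p b) (top τ p, bot τ p) * r *
        Rbar τ (p + 1) (top τ p, bot τ p) (mid τ p c, mid τ p d) := by
  have hr' := left_inv_eq_right_inv ((mul_comm _ _).trans hr) (Rbar_pivot_inverse τ p)
  have hq := q_ne_zero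
  have hξ := xi_ne_zero τ (p + 1)
  have e1 := PowerSeries.mul_inv_cancel (PowerSeries.C q * PowerSeries.X - PowerSeries.C q⁻¹)
    (by simp [hq])
  have e2 := PowerSeries.mul_inv_cancel (PowerSeries.X - PowerSeries.C (xi τ (p + 1)))
    (by simp [hξ])
  have e3 := PowerSeries.mul_inv_cancel (PowerSeries.X - PowerSeries.C (xi τ p))
    (by simp [xi_ne_zero])
  have e4 := PowerSeries.mul_inv_cancel (PowerSeries.X - 1 : K⟦X⟧) (by simp)
  have hC : PowerSeries.C q * PowerSeries.C q⁻¹ = 1 := by rw [← map_mul, mul_inv_cancel₀ hq, map_one]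
  rw [hr', Rbar_apply τ (p + 1) (mid τ p a, mid τ p b) (mid τ p c, mid τ p d), R_mid, P_mid, Q_mid,
    Rbar_apply, Rbar_apply, Rbar_apply, Q_apply τ p, R_apply τ (p + 1), R_apply τ (p + 1),
    P_apply τ (p + 1), P_apply τ (p + 1), Q_apply τ (p + 1), Q_apply τ (p + 1)]
  simp only [top_ne_bot, top_rev, bot_rev, mid_rev, mid_ne_top, mid_ne_bot,
    (mid_ne_top _).symm, (mid_ne_bot _).symm, mid_inj, mid_lt_bot, (mid_lt_bot _).not_gt,
    bar2_mid, and_self, and_true, true_and, if_true, if_false, and_false, map_zero, mul_zero,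
    false_and, add_zero, sub_zero, zero_sub]
  by_cases hab : a = b.rev
  swap
  · simp [hab]
  by_cases hcd : c = d.rev
  swap
  · simp [hcd]
  simp only [hab, hcd, and_self, if_true]
  have hw : qh ^ (bar2 τ p b - bar2 τ p d) = qh ^ (bar2 τ p b - bar2 τ (p + 1) (bot τ p)) *
      qh ^ (bar2 τ (p + 1) (bot τ p) - bar2 τ p d) := by
    rw [← zpow_add₀ qh_ne_zero]; congr 1; ring
  rw [hw]
  rw [xi_succ (τ := τ) (p := p)] at e3 ⊢
  simp only [map_mul, map_sub, map_pow, map_neg] at *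
  generalize (PowerSeries.C q * PowerSeries.X - PowerSeries.C q⁻¹)⁻¹ = g at *
  generalize (PowerSeries.X - PowerSeries.C (xi τ (p + 1)))⁻¹ = h at *
  generalize (PowerSeries.X - PowerSeries.C q ^ 2 * PowerSeries.C (xi τ (p + 1)))⁻¹ = h' at *
  generalize (PowerSeries.X - 1 : K⟦X⟧)⁻¹ = f at *
  generalize PowerSeries.C q⁻¹ = q' at *
  generalize PowerSeries.C q = Q at *
  generalize PowerSeries.C (xi τ (p + 1)) = ξ at *
  generalize PowerSeries.C (qh ^ (bar2 τ p b - bar2 τ (p + 1) (bot τ p))) = w₁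
  generalize PowerSeries.C (qh ^ (bar2 τ (p + 1) (bot τ p) - bar2 τ p d)) = w₂
  generalize (PowerSeries.X : K⟦X⟧) = x at *
  -- The partial fraction identity `q²(x - ξ) = (x - q²ξ) + (q² - 1)x`, divided by both
  -- denominators.
  have key : Q ^ 2 * h' = h + (Q - q') * h * x * Q * h' := by
    linear_combination -Q ^ 2 * h' * e2 + h * e3 + h * h' * x * hC
  have hprod : (-((Q - q') * ξ * (x - 1) * g * h * w₁)) *
      ((Q * x - q') * (x - ξ) * Q * f * h') *
      ((x - 1) * g * -((Q - q') * w₂) - (Q - q') * ξ * (x - 1) * g * h * w₂) =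
      (Q - q') * (Q - q') * ξ * (x - 1) * g * h * x * Q * h' * w₁ * w₂ := by
    calc _ = (Q - q') * (Q - q') * ξ * (x - 1) * g * ((x - 1) * f) * ((Q * x - q') * g) * h *
          ((x - ξ) + ξ * ((x - ξ) * h)) * Q * h' * w₁ * w₂ := by ring
      _ = _ := by rw [e4, e1, e2]; ring
  linear_combination hprod - (Q - q') * ξ * (x - 1) * g * w₁ * w₂ * key

end Reduction

/-! ### Passing an exchange relation to Schur complements -/

section Exchange

variable {τ : OType} {p : ℕ} {S : Type*} [Ring S]

/-- The Schur complement of the top left entry, whose inverse is `A`. -/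
def schur (T : Matrix (Fin (dim τ (p + 1))) (Fin (dim τ (p + 1))) S) (A : S)
    (i j : Fin (dim τ (p + 1))) : S :=
  T i j - T i (top τ p) * A * T (top τ p) j

variable (T T' : Matrix (Fin (dim τ (p + 1))) (Fin (dim τ (p + 1))) S) (A A' : S)
  (G : Matrix (Fin (dim τ p)) (Fin (dim τ p)) S)

theorem schur_top_left (h : T (top τ p) (top τ p) * A = 1) (j : Fin (dim τ (p + 1))) :
    schur T A (top τ p) j = 0 := by
  simp [schur, h]

theorem schur_top_right (h : A * T (top τ p) (top τ p) = 1) (i : Fin (dim τ (p + 1))) :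
    schur T A i (top τ p) = 0 := by
  simp [schur, mul_assoc, h]

/-- A column vector `x` such that `T₁ T'₂ x` has no components of positive degree, with leading
term at `(top, bot)`. -/
def colTB : Fin (dim τ (p + 1)) × Fin (dim τ (p + 1)) → S :=
  Pi.single (top τ p, bot τ p) 1
  - ∑ j, Pi.single (top τ p, mid τ p j) (∑ k, G j k * schur T' A' (mid τ p k) (bot τ p))
  - Pi.single (top τ p, top τ p) (A' * T' (top τ p) (bot τ p)
      - ∑ j, A' * T' (top τ p) (mid τ p j) * ∑ k, G j k * schur T' A' (mid τ p k) (bot τ p))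

/-- A column vector `x` such that `T₁ T'₂ x` has no components of positive degree, with leading
term at `(mid m, mid l)`. -/
def colMM (m l : Fin (dim τ p)) : Fin (dim τ (p + 1)) × Fin (dim τ (p + 1)) → S :=
  Pi.single (mid τ p m, mid τ p l) 1
  - Pi.single (mid τ p m, top τ p) (A' * T' (top τ p) (mid τ p l))
  - ∑ j, Pi.single (top τ p, mid τ p j)
      (∑ k, G j k * (A * T (top τ p) (mid τ p m)) * schur T' A' (mid τ p k) (mid τ p l))
  + Pi.single (top τ p, top τ p) (∑ j, A' * T' (top τ p) (mid τ p j) *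
      ∑ k, G j k * (A * T (top τ p) (mid τ p m)) * schur T' A' (mid τ p k) (mid τ p l))

/-- The row vector `y` dual to `colTB`: `y T'₂ T₁` has no components of positive degree. -/
def rowTB : Fin (dim τ (p + 1)) × Fin (dim τ (p + 1)) → S :=
  Pi.single (top τ p, bot τ p) 1
  - ∑ j, Pi.single (top τ p, mid τ p j) (∑ k, schur T' A' (bot τ p) (mid τ p k) * G k j)
  - Pi.single (top τ p, top τ p) (T' (bot τ p) (top τ p) * A'
      - ∑ j, (∑ k, schur T' A' (bot τ p) (mid τ p k) * G k j) * (T' (mid τ p j) (top τ p) * A'))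

/-- The row vector `y` dual to `colMM`: `y T'₂ T₁` has no components of positive degree. -/
def rowMM (m l : Fin (dim τ p)) : Fin (dim τ (p + 1)) × Fin (dim τ (p + 1)) → S :=
  Pi.single (mid τ p m, mid τ p l) 1
  - Pi.single (mid τ p m, top τ p) (T' (mid τ p l) (top τ p) * A')
  - ∑ j, Pi.single (top τ p, mid τ p j)
      (∑ k, schur T' A' (mid τ p l) (mid τ p k) * (T (mid τ p m) (top τ p) * A) * G k j)
  + Pi.single (top τ p, top τ p) (∑ j, (∑ k, schur T' A' (mid τ p l) (mid τ p k) *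
      (T (mid τ p m) (top τ p) * A) * G k j) * (T' (mid τ p j) (top τ p) * A'))

theorem dotProduct_colTB (r : Fin (dim τ (p + 1)) × Fin (dim τ (p + 1)) → S) :
    r ⬝ᵥ colTB T' A' G = r (top τ p, bot τ p)
      - ∑ j, r (top τ p, mid τ p j) * (∑ k, G j k * schur T' A' (mid τ p k) (bot τ p))
      - r (top τ p, top τ p) * (A' * T' (top τ p) (bot τ p)
      - ∑ j, A' * T' (top τ p) (mid τ p j) * ∑ k, G j k * schur T' A' (mid τ p k) (bot τ p)) := by
  simp only [colTB, dotProduct_sub, dotProduct_sum, dotProduct_single, mul_one]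

theorem dotProduct_colMM (m l : Fin (dim τ p))
    (r : Fin (dim τ (p + 1)) × Fin (dim τ (p + 1)) → S) :
    r ⬝ᵥ colMM T T' A A' G m l = r (mid τ p m, mid τ p l)
      - r (mid τ p m, top τ p) * (A' * T' (top τ p) (mid τ p l))
      - ∑ j, r (top τ p, mid τ p j) *
      (∑ k, G j k * (A * T (top τ p) (mid τ p m)) * schur T' A' (mid τ p k) (mid τ p l))
      + r (top τ p, top τ p) * (∑ j, A' * T' (top τ p) (mid τ p j) *
      ∑ k, G j k * (A * T (top τ p) (mid τ p m)) * schur T' A' (mid τ p k) (mid τ p l)) := by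
  simp only [colMM, dotProduct_sub, dotProduct_add, dotProduct_sum, dotProduct_single, mul_one]

theorem rowTB_dotProduct (r : Fin (dim τ (p + 1)) × Fin (dim τ (p + 1)) → S) :
    rowTB T' A' G ⬝ᵥ r = r (top τ p, bot τ p)
      - ∑ j, (∑ k, schur T' A' (bot τ p) (mid τ p k) * G k j) * r (top τ p, mid τ p j)
      - (T' (bot τ p) (top τ p) * A'
      - ∑ j, (∑ k, schur T' A' (bot τ p) (mid τ p k) * G k j) * (T' (mid τ p j) (top τ p) * A')) *
        r (top τ p, top τ p) := by
  simp only [rowTB, sub_dotProduct, sum_dotProduct, single_dotProduct, one_mul]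

theorem rowMM_dotProduct (m l : Fin (dim τ p))
    (r : Fin (dim τ (p + 1)) × Fin (dim τ (p + 1)) → S) :
    rowMM T T' A A' G m l ⬝ᵥ r = r (mid τ p m, mid τ p l)
      - T' (mid τ p l) (top τ p) * A' * r (mid τ p m, top τ p)
      - ∑ j, (∑ k, schur T' A' (mid τ p l) (mid τ p k) * (T (mid τ p m) (top τ p) * A) * G k j) *
        r (top τ p, mid τ p j)
      + (∑ j, (∑ k, schur T' A' (mid τ p l) (mid τ p k) *
      (T (mid τ p m) (top τ p) * A) * G k j) * (T' (mid τ p j) (top τ p) * A')) *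
        r (top τ p, top τ p) := by
  simp only [rowMM, sub_dotProduct, add_dotProduct, sum_dotProduct, single_dotProduct, one_mul]

/-- The matrix with entries `T_{ik} T'_{jl}`, i.e. `T₁ T'₂`. -/
def prodLR {V : Type*} (T T' : Matrix V V S) : Matrix (V × V) (V × V) S :=
  Matrix.of fun i k => T i.1 k.1 * T' i.2 k.2

/-- The matrix with entries `T'_{jl} T_{ik}`, i.e. `T'₂ T₁`. -/
def prodRL {V : Type*} (T T' : Matrix V V S) : Matrix (V × V) (V × V) S :=
  Matrix.of fun i k => T' i.2 k.2 * T i.1 k.1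

/-- The (top, top) component completes every entry of `T'` to its Schur complement; the sum with `G`
is there to clear the middle values of `t`. -/
theorem prodLR_mulVec_colTB (s t : Fin (dim τ (p + 1))) :
    (prodLR T T').mulVec (colTB T' A' G) (s, t) = T s (top τ p) * (schur T' A' t (bot τ p) -
      ∑ j, schur T' A' t (mid τ p j) * ∑ k, G j k * schur T' A' (mid τ p k) (bot τ p)) := by
  simp only [Matrix.mulVec, dotProduct_colTB, prodLR, Matrix.of_apply, schur, mul_sub, sub_mul,
    Finset.mul_sum, Finset.sum_sub_distrib, mul_assoc]
  abel

theorem prodLR_mulVec_colMM (m l s t : _) :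
    (prodLR T T').mulVec (colMM T T' A A' G m l) (s, t) =
      T s (mid τ p m) * schur T' A' t (mid τ p l) - T s (top τ p) *
      ∑ j, schur T' A' t (mid τ p j) *
        ∑ k, G j k * (A * T (top τ p) (mid τ p m)) * schur T' A' (mid τ p k) (mid τ p l) := by
  simp only [Matrix.mulVec, dotProduct_colMM, prodLR, Matrix.of_apply, schur, mul_sub, sub_mul,
    Finset.mul_sum, Finset.sum_sub_distrib, mul_assoc]
  abel

theorem rowTB_vecMul_prodRL (s t : Fin (dim τ (p + 1))) :
    Matrix.vecMul (rowTB T' A' G) (prodRL T T') (s, t) = (schur T' A' (bot τ p) t -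
      ∑ j, (∑ k, schur T' A' (bot τ p) (mid τ p k) * G k j) * schur T' A' (mid τ p j) t) *
      T (top τ p) s := by
  simp only [Matrix.vecMul, rowTB_dotProduct, prodRL, Matrix.of_apply, schur, mul_sub, sub_mul,
    Finset.sum_mul, Finset.sum_sub_distrib, mul_assoc]
  abel

theorem rowMM_vecMul_prodRL (m l s t : _) :
    Matrix.vecMul (rowMM T T' A A' G m l) (prodRL T T') (s, t) =
      schur T' A' (mid τ p l) t * T (mid τ p m) s -
      (∑ j, (∑ k, schur T' A' (mid τ p l) (mid τ p k) * (T (mid τ p m) (top τ p) * A) * G k j) *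
        schur T' A' (mid τ p j) t) * T (top τ p) s := by
  simp only [Matrix.vecMul, rowMM_dotProduct, prodRL, Matrix.of_apply, schur, mul_sub, sub_mul,
    Finset.sum_mul, Finset.sum_sub_distrib, mul_assoc]
  abel

/-- The square block of the Schur complement with the middle indices. -/
def schurMid : Matrix (Fin (dim τ p)) (Fin (dim τ p)) S :=
  Matrix.of fun i j => schur T A (mid τ p i) (mid τ p j)

theorem sum_schurMid_mul (hG : schurMid T' A' * G = 1) (t : Fin (dim τ p))
    (f : Fin (dim τ p) → S) :
    ∑ j, schur T' A' (mid τ p t) (mid τ p j) * ∑ k, G j k * f k = f t := by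
  have := congrFun (congrArg (fun M => Matrix.mulVec M f) hG) t
  simp only [← Matrix.mulVec_mulVec, Matrix.one_mulVec] at this
  exact this

theorem sum_mul_schurMid (hG : G * schurMid T' A' = 1) (t : Fin (dim τ p))
    (f : Fin (dim τ p) → S) :
    ∑ j, (∑ k, f k * G k j) * schur T' A' (mid τ p j) (mid τ p t) = f t := by
  have := congrFun (congrArg (fun M => Matrix.vecMul f M) hG) t
  simp only [← Matrix.vecMul_vecMul, Matrix.vecMul_one] at this
  exact this

/-- A vector in `V ⊗ V` without components of positive degree and without component
at `(bot, top)`. -/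
def IsLow (c : Fin (dim τ (p + 1)) × Fin (dim τ (p + 1)) → S) : Prop :=
  c (top τ p, top τ p) = 0 ∧ (∀ j, c (top τ p, mid τ p j) = 0) ∧
    (∀ j, c (mid τ p j, top τ p) = 0) ∧ c (bot τ p, top τ p) = 0

/-- `V ⊗ V` is graded by the sum of the degrees; a matrix is graded if it preserves the degree. -/
def IsGraded (a : Matrix (Fin (dim τ (p + 1)) × Fin (dim τ (p + 1)))
    (Fin (dim τ (p + 1)) × Fin (dim τ (p + 1))) S) : Prop :=
  ∀ i j k l, deg τ (p + 1) i + deg τ (p + 1) j ≠ deg τ (p + 1) k + deg τ (p + 1) l →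
    a (i, j) (k, l) = 0

variable {T T' A A' G}
variable {a b : Matrix (Fin (dim τ (p + 1)) × Fin (dim τ (p + 1)))
    (Fin (dim τ (p + 1)) × Fin (dim τ (p + 1))) S}

/-- The positions of positive degree are (top, top), (top, mid) and (mid, top), exactly where a low
vector vanishes besides (bot, top). -/
theorem IsGraded.mulVec_of_pos (ha : IsGraded a)
    {c : Fin (dim τ (p + 1)) × Fin (dim τ (p + 1)) → S} (hc : IsLow c)
    {i j : Fin (dim τ (p + 1))} (hij : 0 < deg τ (p + 1) i + deg τ (p + 1) j) :
    a.mulVec c (i, j) = 0 := by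
  have h0 : ∀ k l, deg τ (p + 1) k + deg τ (p + 1) l ≤ 0 → a (i, j) (k, l) = 0 :=
    fun k l h => ha _ _ _ _ (by omega)
  obtain ⟨h1, h2, h3, -⟩ := hc
  simp only [Matrix.mulVec, dotProduct, Fintype.sum_prod_type, sum_top_mid_bot, h1, h2, h3]
  simp [h0]

theorem IsGraded.mulVec_of_zero (ha : IsGraded a)
    {c : Fin (dim τ (p + 1)) × Fin (dim τ (p + 1)) → S} (hc : IsLow c)
    {i j : Fin (dim τ (p + 1))} (hij : deg τ (p + 1) i + deg τ (p + 1) j = 0) :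
    a.mulVec c (i, j) = a (i, j) (top τ p, bot τ p) * c (top τ p, bot τ p) +
      ∑ s, ∑ t, a (i, j) (mid τ p s, mid τ p t) * c (mid τ p s, mid τ p t) := by
  have h0 : ∀ k l, deg τ (p + 1) k + deg τ (p + 1) l ≠ 0 → a (i, j) (k, l) = 0 :=
    fun k l h => ha _ _ _ _ (by omega)
  obtain ⟨h1, h2, h3, h4⟩ := hc
  simp only [Matrix.mulVec, dotProduct, Fintype.sum_prod_type, sum_top_mid_bot, h1, h2, h3, h4]
  simp [h0]

theorem IsGraded.vecMul_of_pos (hb : IsGraded b)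
    {c : Fin (dim τ (p + 1)) × Fin (dim τ (p + 1)) → S} (hc : IsLow c)
    {i j : Fin (dim τ (p + 1))} (hij : 0 < deg τ (p + 1) i + deg τ (p + 1) j) :
    Matrix.vecMul c b (i, j) = 0 := by
  have h0 : ∀ k l, deg τ (p + 1) k + deg τ (p + 1) l ≤ 0 → b (k, l) (i, j) = 0 :=
    fun k l h => hb _ _ _ _ (by omega)
  obtain ⟨h1, h2, h3, -⟩ := hc
  simp only [Matrix.vecMul, dotProduct, Fintype.sum_prod_type, sum_top_mid_bot, h1, h2, h3]
  simp [h0]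

theorem IsGraded.vecMul_of_zero (hb : IsGraded b)
    {c : Fin (dim τ (p + 1)) × Fin (dim τ (p + 1)) → S} (hc : IsLow c)
    {i j : Fin (dim τ (p + 1))} (hij : deg τ (p + 1) i + deg τ (p + 1) j = 0) :
    Matrix.vecMul c b (i, j) = c (top τ p, bot τ p) * b (top τ p, bot τ p) (i, j) +
      ∑ s, ∑ t, c (mid τ p s, mid τ p t) * b (mid τ p s, mid τ p t) (i, j) := by
  have h0 : ∀ k l, deg τ (p + 1) k + deg τ (p + 1) l ≠ 0 → b (k, l) (i, j) = 0 :=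
    fun k l h => hb _ _ _ _ (by omega)
  obtain ⟨h1, h2, h3, h4⟩ := hc
  simp only [Matrix.vecMul, dotProduct, Fintype.sum_prod_type, sum_top_mid_bot, h1, h2, h3, h4]
  simp [h0]

theorem isLow_colTB (hA' : T' (top τ p) (top τ p) * A' = 1) (hG : schurMid T' A' * G = 1) :
    IsLow ((prodLR T T').mulVec (colTB T' A' G)) ∧
      ∀ s t, (prodLR T T').mulVec (colTB T' A' G) (mid τ p s, mid τ p t) = 0 := by
  simp only [IsLow, prodLR_mulVec_colTB, schur_top_left _ _ hA', sum_schurMid_mul _ _ _ hG]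
  simp

/-- For middle `t`, `G` cancels against the middle Schur block. The factor `A * T top m`, placed
between `G` and the Schur complement of `T'` to respect the order of multiplication, then turns `T s
m` into its own Schur complement. -/
theorem isLow_colMM (hA : T (top τ p) (top τ p) * A = 1)
    (hA' : T' (top τ p) (top τ p) * A' = 1) (hG : schurMid T' A' * G = 1) (m l : Fin (dim τ p)) :
    IsLow ((prodLR T T').mulVec (colMM T T' A A' G m l)) ∧
      ∀ s t, (prodLR T T').mulVec (colMM T T' A A' G m l) (mid τ p s, mid τ p t) =
        schurMid T A s m * schurMid T' A' t l := by
  have h : ∀ x y : S, T (top τ p) (top τ p) * (A * x * y) = x * y := fun x y => by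
    rw [mul_assoc A, ← mul_assoc, hA, one_mul]
  simp only [IsLow, prodLR_mulVec_colMM, schur_top_left _ _ hA', mul_assoc (G _ _),
    sum_schurMid_mul _ _ _ hG, h]
  simp [schurMid, schur, sub_mul, mul_assoc]

theorem isLow_rowTB (hA' : A' * T' (top τ p) (top τ p) = 1) (hG : G * schurMid T' A' = 1) :
    IsLow (Matrix.vecMul (rowTB T' A' G) (prodRL T T')) ∧
      ∀ s t, Matrix.vecMul (rowTB T' A' G) (prodRL T T') (mid τ p s, mid τ p t) = 0 := by
  simp only [IsLow, rowTB_vecMul_prodRL, schur_top_right _ _ hA', sum_mul_schurMid _ _ _ hG]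
  simp

theorem isLow_rowMM (hA : A * T (top τ p) (top τ p) = 1)
    (hA' : A' * T' (top τ p) (top τ p) = 1) (hG : G * schurMid T' A' = 1) (m l : Fin (dim τ p)) :
    IsLow (Matrix.vecMul (rowMM T T' A A' G m l) (prodRL T T')) ∧
      ∀ s t, Matrix.vecMul (rowMM T T' A A' G m l) (prodRL T T') (mid τ p s, mid τ p t) =
        schurMid T' A' l t * schurMid T A m s := by
  have h : ∀ x y : S, x * (y * A) * T (top τ p) (top τ p) = x * y := fun x y => by
    rw [mul_assoc, mul_assoc, hA, mul_one]
  simp only [IsLow, rowMM_vecMul_prodRL, schur_top_right _ _ hA',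
    sum_mul_schurMid _ _ _ hG, h]
  simp [schurMid, schur, mul_sub, mul_assoc]

/-- This is `a [k w; 0 X] = [k' 0; w' Y] b` with `xᵢ = aᵢ₂ X` and `yᵢ = Y b₂ᵢ`. Neither `k` nor `k'`
has to be invertible: the first equation gives `ra k' = k rb`, which suffices. -/
theorem schur_of_triangular {a₁₁ a₂₁ b₁₁ b₁₂ k k' w w' x₁ x₂ y₁ y₂ ra rb : S}
    (e₁₁ : a₁₁ * k = k' * b₁₁) (e₁₂ : a₁₁ * w + x₁ = k' * b₁₂) (e₂₁ : a₂₁ * k = w' * b₁₁ + y₁)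
    (e₂₂ : a₂₁ * w + x₂ = w' * b₁₂ + y₂) (hra : ra * a₁₁ = 1) (hrb : b₁₁ * rb = 1) :
    x₂ - a₂₁ * ra * x₁ = y₂ - y₁ * rb * b₁₂ := by
  have h₁ : x₁ = k' * b₁₂ - a₁₁ * w := by rw [← e₁₂]; abel
  have h₂ : x₂ = w' * b₁₂ + y₂ - a₂₁ * w := by rw [← e₂₂]; abel
  have h₃ : y₁ = a₂₁ * k - w' * b₁₁ := by rw [e₂₁]; abel
  have h₄ : a₂₁ * ra * a₁₁ = a₂₁ := by rw [mul_assoc, hra, mul_one]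
  have h₅ : w' * b₁₁ * rb = w' := by rw [mul_assoc, hrb, mul_one]
  have h₆ : a₂₁ * ra * k' = a₂₁ * k * rb := by
    calc a₂₁ * ra * k' = a₂₁ * ra * (k' * b₁₁ * rb) := by rw [mul_assoc k', hrb, mul_one]
      _ = a₂₁ * (ra * a₁₁) * k * rb := by rw [← e₁₁]; simp only [mul_assoc]
      _ = _ := by rw [hra, mul_one]
  rw [h₁, h₂, h₃, mul_sub, ← mul_assoc, ← mul_assoc, h₄, h₆, sub_mul, sub_mul, h₅]
  abel

/-- The exchange relation passes to Schur complements. -/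
theorem schur_exchange (ha : IsGraded a) (hb : IsGraded b)
    (H : a * prodLR T T' = prodRL T T' * b)
    (hA : T (top τ p) (top τ p) * A = 1) (hA₂ : A * T (top τ p) (top τ p) = 1)
    (hA' : T' (top τ p) (top τ p) * A' = 1) (hA'₂ : A' * T' (top τ p) (top τ p) = 1)
    (hG : schurMid T' A' * G = 1) (hG₂ : G * schurMid T' A' = 1) {ra rb : S}
    (hra : ra * a (top τ p, bot τ p) (top τ p, bot τ p) = 1)
    (hrb : b (top τ p, bot τ p) (top τ p, bot τ p) * rb = 1) (i j m l : Fin (dim τ p)) :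
    ∑ s, ∑ t, (a (mid τ p i, mid τ p j) (mid τ p s, mid τ p t)
        - a (mid τ p i, mid τ p j) (top τ p, bot τ p) * ra *
          a (top τ p, bot τ p) (mid τ p s, mid τ p t)) *
        (schurMid T A s m * schurMid T' A' t l) =
      ∑ s, ∑ t, (schurMid T' A' j t * schurMid T A i s) *
        (b (mid τ p s, mid τ p t) (mid τ p m, mid τ p l)
        - b (mid τ p s, mid τ p t) (top τ p, bot τ p) * rb *
          b (top τ p, bot τ p) (mid τ p m, mid τ p l)) := by
  have key : ∀ x y, y ⬝ᵥ a.mulVec ((prodLR T T').mulVec x) =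
      Matrix.vecMul (Matrix.vecMul y (prodRL T T')) b ⬝ᵥ x := fun x y => by
    rw [Matrix.mulVec_mulVec, H, Matrix.dotProduct_mulVec, Matrix.vecMul_vecMul]
  obtain ⟨c1, c1'⟩ := isLow_colTB (T := T) hA' hG
  obtain ⟨c2, c2'⟩ := isLow_colMM (T := T) hA hA' hG m l
  obtain ⟨r1, r1'⟩ := isLow_rowTB (T := T) hA'₂ hG₂
  obtain ⟨r2, r2'⟩ := isLow_rowMM (T := T) hA₂ hA'₂ hG₂ i j
  have e11 := key (colTB T' A' G) (rowTB T' A' G)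
  have e12 := key (colMM T T' A A' G m l) (rowTB T' A' G)
  have e21 := key (colTB T' A' G) (rowMM T T' A A' G i j)
  have e22 := key (colMM T T' A A' G m l) (rowMM T T' A A' G i j)
  simp only [rowTB_dotProduct, rowMM_dotProduct, dotProduct_colTB, dotProduct_colMM] at e11 e12 e21 e22
  -- Apart from their leading terms the test rows and columns live in positive degree, where these
  -- products vanish. Each pairing therefore reads off one coordinate of degree zero.
  have z1 : ∀ c, IsLow c → a.mulVec c (top τ p, top τ p) = 0 ∧
      (∀ j, a.mulVec c (top τ p, mid τ p j) = 0) ∧ (∀ j, a.mulVec c (mid τ p j, top τ p) = 0) :=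
    fun c hc => ⟨ha.mulVec_of_pos hc (by simp), fun j => ha.mulVec_of_pos hc (by simp),
      fun j => ha.mulVec_of_pos hc (by simp)⟩
  have z2 : ∀ c, IsLow c → Matrix.vecMul c b (top τ p, top τ p) = 0 ∧
      (∀ j, Matrix.vecMul c b (top τ p, mid τ p j) = 0) ∧
      (∀ j, Matrix.vecMul c b (mid τ p j, top τ p) = 0) :=
    fun c hc => ⟨hb.vecMul_of_pos hc (by simp), fun j => hb.vecMul_of_pos hc (by simp),
      fun j => hb.vecMul_of_pos hc (by simp)⟩
  simp only [z1 _ c1, z1 _ c2, z2 _ r1, z2 _ r2, mul_zero, zero_mul, Finset.sum_const_zero,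
    sub_zero, add_zero] at e11 e12 e21 e22
  rw [ha.mulVec_of_zero c1 (by simp), hb.vecMul_of_zero r1 (by simp)] at e11
  rw [ha.mulVec_of_zero c2 (by simp), hb.vecMul_of_zero r1 (by simp)] at e12
  rw [ha.mulVec_of_zero c1 (by simp), hb.vecMul_of_zero r2 (by simp)] at e21
  rw [ha.mulVec_of_zero c2 (by simp), hb.vecMul_of_zero r2 (by simp)] at e22
  simp only [c1', c2', r1', r2', mul_zero, zero_mul, Finset.sum_const_zero, add_zero] at e11 e12 e21 e22
  simp only [sub_mul, mul_sub, Finset.sum_sub_distrib]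
  simp only [mul_assoc, ← Finset.mul_sum]
  simp only [← mul_assoc, ← Finset.sum_mul]
  simp only [← mul_assoc] at e11 e12 e21 e22
  exact schur_of_triangular e11 e12 e21 e22 hra hrb

end Exchange

/-! ### Series in `u`, `v` as power series in two monomials -/

section TwoVariables

open PowerSeries

variable {A : Type*} [Ring A]

/-- The substitution `t ↦ x y z` into `A⟦x⟧⟦y⟧` for a central element `z`. -/
def diagHom (z : A) (hz : ∀ a, Commute z a) : A⟦X⟧ →+* A⟦X⟧⟦X⟧ where
  toFun f := mk fun k => monomial k (z ^ k * coeff k f)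
  map_one' := by
    ext b a
    rcases eq_or_ne b 0 with rfl | hb
    · simp [coeff_one]
    · simp [coeff_one, hb]
  map_zero' := by ext b a; simp
  map_add' f g := by ext b a; simp [mul_add]
  map_mul' f g := by
    ext1 b
    rw [coeff_mk, coeff_mul, coeff_mul, Finset.mul_sum, map_sum]
    refine Finset.sum_congr rfl fun k hk => ?_
    rw [coeff_mk, coeff_mk, monomial_mul_monomial, Finset.HasAntidiagonal.mem_antidiagonal.1 hk,
      ← Finset.HasAntidiagonal.mem_antidiagonal.1 hk, pow_add, mul_assoc, mul_assoc,
      ← mul_assoc (coeff k.1 f), ← ((hz (coeff k.1 f)).pow_left k.2).eq, mul_assoc]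

variable (z : A) (hz : ∀ a, Commute z a)

theorem coeff_diagHom (f : A⟦X⟧) (a b : ℕ) :
    coeff a (coeff b (diagHom z hz f)) = if a = b then z ^ a * coeff a f else 0 := by
  simp only [diagHom, RingHom.coe_mk, MonoidHom.coe_mk, OneHom.coe_mk, coeff_mk, coeff_monomial]
  split_ifs with h <;> simp [h]

theorem coeff_monomial_mul' (i : ℕ) (m : A) (g : A⟦X⟧) (a : ℕ) :
    coeff a (monomial i m * g) = if i ≤ a then m * coeff (a - i) g else 0 := by
  rw [monomial_eq_C_mul_X_pow, mul_assoc, coeff_C_mul, coeff_X_pow_mul', mul_ite, mul_zero]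

theorem coeff_C_mul₂ (f : A⟦X⟧) (g : A⟦X⟧⟦X⟧) (a b : ℕ) :
    coeff a (coeff b (C f * g)) =
      ∑ k ∈ Finset.range (a + 1), coeff k f * coeff (a - k) (coeff b g) := by
  rw [coeff_C_mul, coeff_mul, Finset.Nat.sum_antidiagonal_eq_sum_range_succ_mk]

theorem coeff_mapC_mul (f : A⟦X⟧) (g : A⟦X⟧⟦X⟧) (a b : ℕ) :
    coeff a (coeff b (map C f * g)) =
      ∑ k ∈ Finset.range (b + 1), coeff k f * coeff a (coeff (b - k) g) := by
  rw [coeff_mul, Finset.Nat.sum_antidiagonal_eq_sum_range_succ_mk, map_sum]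
  simp

theorem coeff_diagHom_mul (f : A⟦X⟧) (g : A⟦X⟧⟦X⟧) (a b : ℕ) :
    coeff a (coeff b (diagHom z hz f * g)) =
      ∑ k ∈ Finset.range (b + 1),
        if k ≤ a then z ^ k * coeff k f * coeff (a - k) (coeff (b - k) g) else 0 := by
  rw [coeff_mul, Finset.Nat.sum_antidiagonal_eq_sum_range_succ_mk, map_sum]
  simp [diagHom, coeff_monomial_mul']

/-- The pairs of signs for which there is a defining relation. -/
inductive Mode
  | same (ε : Sgn)
  | mixed

def Mode.fst : Mode → Sgn
  | .same ε => ε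
  | .mixed => .plus

def Mode.snd : Mode → Sgn
  | .same ε => ε
  | .mixed => .minus

/-- The series in `u^{±1}` as series in `x` and `y`, where `x = u/v, y = v` for the signs `(+,+)`,
`x = u/v, y = u⁻¹` for `(-,-)` and `x = u, y = v⁻¹` for `(+,-)`. -/
def Mode.homU : Mode → (A⟦X⟧ →+* A⟦X⟧⟦X⟧)
  | .same .plus => diagHom 1 (Commute.one_left ·)
  | .same .minus => map C
  | .mixed => C

/-- The series in `v^{±1}` as series in `x` and `y`. -/
def Mode.homV : Mode → (A⟦X⟧ →+* A⟦X⟧⟦X⟧)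
  | .same .plus => map C
  | .same .minus => diagHom 1 (Commute.one_left ·)
  | .mixed => map C

/-- The series in `uz/v` as series in `x` and `y`; we have `z = 1` unless the signs are `(+,-)`. -/
def Mode.homR [Algebra K A] : Mode → (K⟦X⟧ →+* A⟦X⟧⟦X⟧)
  | .same _ => C.comp (map (algebraMap K A))
  | .mixed => (diagHom z hz).comp (map (algebraMap K A))

/-- The exponents `(r, s)` for which `x^a y^b = u^r v^s`. -/
def Mode.expU : Mode → ℕ → ℕ → ℤ
  | .same .plus, a, _ => a
  | .same .minus, a, b => a - b
  | .mixed, a, _ => a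

def Mode.expV : Mode → ℕ → ℕ → ℤ
  | .same .plus, a, b => b - a
  | .same .minus, a, _ => -a
  | .mixed, _, b => -b

/-- The coefficient of `u^r` in a series in `u^{±1}`. -/
def zcoeff : Sgn → A⟦X⟧ → ℤ → A
  | .plus, f, r => if 0 ≤ r then coeff r.toNat f else 0
  | .minus, f, r => if r ≤ 0 then coeff (-r).toNat f else 0

/-- The monomials substituted for `u^{±1}` and `v^{±1}` have independent exponents, so at most one
term of the convolution contributes to `x^a y^b`. -/
theorem coeff_homU_mul_homV (M : Mode) (f g : A⟦X⟧) (a b : ℕ) :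
    coeff a (coeff b (M.homU f * M.homV g)) =
      zcoeff M.fst f (M.expU a b) * zcoeff M.snd g (M.expV a b) := by
  rcases M with (_ | _) | _
  · simp only [Mode.homU, Mode.homV, coeff_diagHom_mul, Mode.fst, Mode.snd, zcoeff, Mode.expU,
      Mode.expV, one_pow, one_mul, coeff_map, coeff_C, mul_ite, mul_zero]
    by_cases h : a ≤ b
    · have : ((b : ℤ) - a).toNat = b - a := by omega
      rw [Finset.sum_eq_single a]
      · simp [h, this]
      · intro k _ hk
        split_ifs <;> first | rfl | omega
      · simp; omega
    · rw [Finset.sum_eq_zero, if_neg (by omega : ¬ (0 : ℤ) ≤ b - a)]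
      intro k hk
      simp only [Finset.mem_range] at hk
      split_ifs <;> first | rfl | omega
  · simp only [Mode.homU, Mode.homV, coeff_mapC_mul, Mode.fst, Mode.snd, zcoeff, Mode.expU,
      Mode.expV, one_pow, one_mul, coeff_diagHom, mul_ite, mul_zero]
    by_cases h : a ≤ b
    · rw [Finset.sum_eq_single (b - a)]
      · have h' : a = b - (b - a) := by omega
        simp [h, ← h']
      · intro k hk hk'
        simp only [Finset.mem_range] at hk
        split_ifs <;> first | rfl | omega
      · simp
    · rw [Finset.sum_eq_zero, if_neg (by omega : ¬ (a : ℤ) - b ≤ 0)]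
      · simp
      intro k hk
      simp only [Finset.mem_range] at hk
      split_ifs <;> first | rfl | omega
  · simp [Mode.homU, Mode.homV, coeff_C_mul, Mode.fst, Mode.snd, zcoeff, Mode.expU, Mode.expV]

theorem coeff_homV_mul_homU (M : Mode) (f g : A⟦X⟧) (a b : ℕ) :
    coeff a (coeff b (M.homV g * M.homU f)) =
      zcoeff M.snd g (M.expV a b) * zcoeff M.fst f (M.expU a b) := by
  rcases M with (_ | _) | _
  · simp only [Mode.homU, Mode.homV, coeff_mapC_mul, Mode.fst, Mode.snd, zcoeff, Mode.expU,
      Mode.expV, one_pow, one_mul, coeff_diagHom, mul_ite, mul_zero]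
    by_cases h : a ≤ b
    · rw [Finset.sum_eq_single (b - a)]
      · have h' : a = b - (b - a) := by omega
        simp [h, ← h']
      · intro k hk hk'
        simp only [Finset.mem_range] at hk
        split_ifs <;> first | rfl | omega
      · simp
    · rw [Finset.sum_eq_zero, if_neg (by omega : ¬ (0 : ℤ) ≤ b - a)]
      · simp
      intro k hk
      simp only [Finset.mem_range] at hk
      split_ifs <;> first | rfl | omega
  · simp only [Mode.homU, Mode.homV, coeff_diagHom_mul, Mode.fst, Mode.snd, zcoeff, Mode.expU,
      Mode.expV, one_pow, one_mul, coeff_map, coeff_C, mul_ite, mul_zero]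
    by_cases h : a ≤ b
    · rw [Finset.sum_eq_single a]
      · simp [h]
      · intro k _ hk
        split_ifs <;> first | rfl | omega
      · simp; omega
    · rw [Finset.sum_eq_zero, if_neg (by omega : ¬ (a : ℤ) - b ≤ 0)]
      intro k hk
      simp only [Finset.mem_range] at hk
      split_ifs <;> first | rfl | omega
  · simp [Mode.homU, Mode.homV, Mode.fst, Mode.snd, zcoeff, Mode.expU, Mode.expV]

/-- Multiplication by a series in `uz/v`, in terms of the coefficients of `u^r v^s`. -/
theorem coeff_homR_mul [Algebra K A] (M : Mode) (hM : ∀ ε, M = .same ε → z = 1) (F : K⟦X⟧)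
    (W : A⟦X⟧⟦X⟧) (w : ℤ → ℤ → A)
    (hw : ∀ a b, coeff a (coeff b W) = w (M.expU a b) (M.expV a b))
    (hw₀ : ∀ r s, (∀ a b, r = M.expU a b → s ≠ M.expV a b) → w r s = 0) (a b : ℕ) :
    coeff a (coeff b (M.homR z hz F * W)) =
      ∑ k ∈ Finset.range ((M.expU a b).natAbs + (M.expV a b).natAbs + 1),
        z ^ k * (algebraMap K A (coeff k F) * w (M.expU a b - k) (M.expV a b + k)) := by
  rcases M with ε | _
  · obtain rfl := hM ε rfl
    have hU : ∀ k ≤ a, (Mode.same ε).expU (a - k) b = (Mode.same ε).expU a b - k := by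
      intro k hk; cases ε <;> simp only [Mode.expU] <;> omega
    have hV : ∀ k ≤ a, (Mode.same ε).expV (a - k) b = (Mode.same ε).expV a b + k := by
      intro k hk; cases ε <;> simp only [Mode.expV] <;> omega
    simp only [Mode.homR, RingHom.comp_apply, coeff_C_mul₂, coeff_map, one_pow, one_mul]
    -- The convolution stops at `k = a`; the further terms up to `|r| + |s|` have exponents that no
    -- monomial in `x`, `y` attains, so `hw₀` kills them.
    refine (Finset.sum_congr rfl fun k hk => ?_).trans (Finset.sum_subset ?_ ?_)
    · have hk := Nat.lt_succ_iff.1 (Finset.mem_range.1 hk)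
      rw [hw, hU k hk, hV k hk]
    · refine Finset.range_mono (Nat.succ_le_succ ?_)
      cases ε <;> simp [Mode.expU, Mode.expV]
    · intro k _ hk
      rw [Finset.mem_range] at hk
      rw [hw₀, mul_zero]
      intro a' b'
      cases ε <;> simp only [Mode.expU, Mode.expV] <;> omega
  · simp only [Mode.homR, RingHom.comp_apply, coeff_diagHom_mul, coeff_map]
    refine (Finset.sum_congr rfl fun k hk => ?_).trans (Finset.sum_subset ?_ ?_)
    · have hk := Nat.lt_succ_iff.1 (Finset.mem_range.1 hk)
      split_ifs with h
      · rw [hw, mul_assoc]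
        simp only [Mode.expU, Mode.expV, Nat.cast_sub h, Nat.cast_sub hk, neg_sub', sub_neg_eq_add]
      · rw [hw₀, mul_zero, mul_zero]
        intro a' b'
        simp only [Mode.expU, Mode.expV]; omega
    · refine Finset.range_mono (Nat.succ_le_succ ?_)
      simp [Mode.expU, Mode.expV]
    · intro k _ hk
      rw [Finset.mem_range] at hk
      rw [hw₀, mul_zero, mul_zero]
      intro a' b'
      simp only [Mode.expU, Mode.expV]; omega

/-- The coefficients are scalars times powers of the central `z`. This lets `R̄` be moved from the
right of a product to the left. -/
theorem homR_commute [Algebra K A] (M : Mode) (F : K⟦X⟧) (W : A⟦X⟧⟦X⟧) :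
    Commute (M.homR z hz F) W := by
  rcases M with ε | _
  · ext b a
    rw [Mode.homR, RingHom.comp_apply, coeff_C_mul, coeff_mul_C, coeff_mul, coeff_mul,
      ← Finset.Nat.sum_antidiagonal_swap]
    refine Finset.sum_congr rfl fun k _ => ?_
    simp [Algebra.commutes]
  · ext b a
    rw [coeff_mul, coeff_mul, ← Finset.Nat.sum_antidiagonal_swap, map_sum, map_sum]
    refine Finset.sum_congr rfl fun k _ => ?_
    rw [coeff_mul, coeff_mul, ← Finset.Nat.sum_antidiagonal_swap]
    refine Finset.sum_congr rfl fun k' _ => ?_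
    simp only [Mode.homR, RingHom.comp_apply, coeff_diagHom, coeff_map, Prod.fst_swap,
      Prod.snd_swap]
    split_ifs
    · exact (((hz _).pow_left _).mul_left (Algebra.commutes _ _)).eq
    · simp

theorem zcoeff_mul_eq_zero (M : Mode) (f g : A⟦X⟧) (r s : ℤ)
    (h : ∀ a b, r = M.expU a b → s ≠ M.expV a b) :
    zcoeff M.fst f r * zcoeff M.snd g s = 0 ∧ zcoeff M.snd g s * zcoeff M.fst f r = 0 := by
  suffices zcoeff M.fst f r = 0 ∨ zcoeff M.snd g s = 0 by rcases this with h | h <;> simp [h]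
  rcases M with (_ | _) | _
  · have := h r.toNat (r + s).toNat
    simp only [Mode.fst, Mode.snd, zcoeff, Mode.expU, Mode.expV] at this ⊢
    split_ifs <;> first | simp | omega
  · have := h (-s).toNat (-r - s).toNat
    simp only [Mode.fst, Mode.snd, zcoeff, Mode.expU, Mode.expV] at this ⊢
    split_ifs <;> first | simp | omega
  · have := h r.toNat (-s).toNat
    simp only [Mode.fst, Mode.snd, zcoeff, Mode.expU, Mode.expV] at this ⊢
    split_ifs <;> first | simp | omega

end TwoVariables

/-! ### The `RLL` relations as identities of generating series -/

section Generating

open PowerSeries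

variable {τ : OType} {n : ℕ} {A : Type} [Ring A]

/-- The generating matrix `𝓛^±(u)` of a family `l`. -/
def genMatrix (l : Sgn → Fin (dim τ n) → Fin (dim τ n) → ℕ → A) (ε : Sgn) :
    Matrix (Fin (dim τ n)) (Fin (dim τ n)) A⟦X⟧ :=
  Matrix.of fun i j => mk (l ε i j)

variable (l : Sgn → Fin (dim τ n) → Fin (dim τ n) → ℕ → A)

theorem Lcoeff_apply (ε : Sgn) (r : ℤ) (i j : Fin (dim τ n)) :
    Lcoeff l ε r i j = zcoeff ε (genMatrix l ε i j) r := by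
  cases ε <;> simp only [Lcoeff, zcoeff, genMatrix] <;> split_ifs <;> simp

variable [Algebra K A]

theorem rllLeft_apply (t : A) (ε₁ ε₂ : Sgn) (r s : ℤ) (i k : Fin (dim τ n) × Fin (dim τ n)) :
    rllLeft l t ε₁ ε₂ r s i k = ∑ m ∈ Finset.range (r.natAbs + s.natAbs + 1),
      ∑ j, t ^ m * (algebraMap K A (coeff m (Rbar τ n i j)) *
        (zcoeff ε₁ (genMatrix l ε₁ j.1 k.1) (r - m) *
          zcoeff ε₂ (genMatrix l ε₂ j.2 k.2) (s + m))) := by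
  simp only [rllLeft, Matrix.sum_apply, Matrix.smul_apply, smul_eq_mul, ← Finset.mul_sum]
  refine Finset.sum_congr rfl fun m _ => ?_
  congr 1
  rw [mul_assoc, Matrix.mul_apply]
  refine Finset.sum_congr rfl fun j _ => ?_
  congr 1
  simp [Matrix.mul_apply, Fintype.sum_prod_type, Matrix.kroneckerMap_apply, Matrix.one_apply,
    Lcoeff_apply]

theorem rllRight_apply (t : A) (ε₁ ε₂ : Sgn) (r s : ℤ) (i k : Fin (dim τ n) × Fin (dim τ n)) :
    rllRight l t ε₁ ε₂ r s i k = ∑ m ∈ Finset.range (r.natAbs + s.natAbs + 1),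
      ∑ j, t ^ m * (algebraMap K A (coeff m (Rbar τ n j k)) *
        (zcoeff ε₂ (genMatrix l ε₂ i.2 j.2) (s + m) *
          zcoeff ε₁ (genMatrix l ε₁ i.1 j.1) (r - m))) := by
  simp only [rllRight, Matrix.sum_apply, Matrix.smul_apply, smul_eq_mul, ← Finset.mul_sum]
  refine Finset.sum_congr rfl fun m _ => ?_
  congr 1
  rw [Matrix.mul_apply]
  refine Finset.sum_congr rfl fun j _ => ?_
  rw [Algebra.commutes]
  congr 1
  simp [Matrix.mul_apply, Fintype.sum_prod_type, Matrix.kroneckerMap_apply, Matrix.one_apply,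
    Lcoeff_apply]

variable (M : Mode) {t t' : A} (ht : ∀ a, Commute t a) (ht' : ∀ a, Commute t' a)

theorem rllLeft_eq_coeff (hM : ∀ ε, M = .same ε → t = 1) (a b : ℕ)
    (i k : Fin (dim τ n) × Fin (dim τ n)) :
    rllLeft l t M.fst M.snd (M.expU a b) (M.expV a b) i k =
      coeff a (coeff b (((Rbar τ n).map (M.homR t ht) *
        prodLR ((genMatrix l M.fst).map M.homU) ((genMatrix l M.snd).map M.homV)) i k)) := by
  rw [rllLeft_apply, Finset.sum_comm, Matrix.mul_apply, map_sum, map_sum]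
  refine Finset.sum_congr rfl fun j _ => ?_
  simp only [Matrix.map_apply, prodLR, Matrix.of_apply]
  rw [coeff_homR_mul t ht M hM _ _
    (fun r s => zcoeff M.fst (genMatrix l M.fst j.1 k.1) r *
      zcoeff M.snd (genMatrix l M.snd j.2 k.2) s)
    (fun a b => coeff_homU_mul_homV M _ _ a b)
    (fun r s h => (zcoeff_mul_eq_zero M _ _ r s h).1)]

theorem rllRight_eq_coeff (hM : ∀ ε, M = .same ε → t = 1) (a b : ℕ)
    (i k : Fin (dim τ n) × Fin (dim τ n)) :
    rllRight l t M.fst M.snd (M.expU a b) (M.expV a b) i k =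
      coeff a (coeff b ((prodRL ((genMatrix l M.fst).map M.homU) ((genMatrix l M.snd).map M.homV) *
        (Rbar τ n).map (M.homR t ht)) i k)) := by
  rw [rllRight_apply, Finset.sum_comm, Matrix.mul_apply, map_sum, map_sum]
  refine Finset.sum_congr rfl fun j _ => ?_
  simp only [Matrix.map_apply, prodRL, Matrix.of_apply]
  rw [← (homR_commute t ht M _ _).eq, coeff_homR_mul t ht M hM _ _
    (fun r s => zcoeff M.snd (genMatrix l M.snd i.2 j.2) s *
      zcoeff M.fst (genMatrix l M.fst i.1 j.1) r)
    (fun a b => coeff_homV_mul_homU M _ _ a b)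
    (fun r s h => (zcoeff_mul_eq_zero M _ _ r s h).2)]

/-- Since `u/v` is itself `x` or `xy`, the attained exponents are stable under multiplication by it,
and their complement under division. -/
theorem expU_ne (r s : ℤ) (h : ∀ a b, r = M.expU a b → s ≠ M.expV a b) (m : ℕ) :
    ∀ a b, r - m = M.expU a b → s + m ≠ M.expV a b := by
  rcases M with (_ | _) | _
  · intro a b
    have := h (a + m) b
    simp only [Mode.expU, Mode.expV] at this ⊢; omega
  · intro a b
    have := h (a + m) b
    simp only [Mode.expU, Mode.expV] at this ⊢; omega
  · intro a b
    have := h (a + m) (b + m)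
    simp only [Mode.expU, Mode.expV] at this ⊢; omega

theorem rll_eq_zero (r s : ℤ) (h : ∀ a b, r = M.expU a b → s ≠ M.expV a b)
    (i k : Fin (dim τ n) × Fin (dim τ n)) :
    rllLeft l t M.fst M.snd r s i k = 0 ∧ rllRight l t M.fst M.snd r s i k = 0 := by
  rw [rllLeft_apply, rllRight_apply]
  constructor <;>
  · refine Finset.sum_eq_zero fun m _ => Finset.sum_eq_zero fun j _ => ?_
    simp [zcoeff_mul_eq_zero M _ _ _ _ (expU_ne M r s h m)]

/-- The `RLL` relations for the coefficients are equivalent to an identity of power series in two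
variables. -/
theorem rll_iff (hM : ∀ ε, M = .same ε → t = 1) (hM' : ∀ ε, M = .same ε → t' = 1) :
    (∀ r s i k, rllLeft l t M.fst M.snd r s i k = rllRight l t' M.fst M.snd r s i k) ↔
      (Rbar τ n).map (M.homR t ht) *
        prodLR ((genMatrix l M.fst).map M.homU) ((genMatrix l M.snd).map M.homV) =
      prodRL ((genMatrix l M.fst).map M.homU) ((genMatrix l M.snd).map M.homV) *
        (Rbar τ n).map (M.homR t' ht') := by
  constructor
  · intro h
    ext i k b a
    rw [← rllLeft_eq_coeff l M ht hM, ← rllRight_eq_coeff l M ht' hM', h]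
  · intro h r s i k
    by_cases hrs : ∀ a b, r = M.expU a b → s ≠ M.expV a b
    · rw [(rll_eq_zero l M r s hrs i k).1, (rll_eq_zero l M r s hrs i k).2]
    · push Not at hrs
      obtain ⟨a, b, rfl, rfl⟩ := hrs
      rw [rllLeft_eq_coeff l M ht hM, rllRight_eq_coeff l M ht' hM', h]

end Generating

/-! ### Invertibility of triangular matrices and of matrices of power series -/

section Units

open PowerSeries

variable {A : Type*} [Ring A]

/-- A triangular matrix over a ring with invertible diagonal entries is invertible. -/
theorem isUnit_of_upper {N : ℕ} (M : Matrix (Fin N) (Fin N) A) (h : ∀ i j, j < i → M i j = 0)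
    (hd : ∀ i, IsUnit (M i i)) : IsUnit M := by
  choose d hd using hd
  set D : Matrix (Fin N) (Fin N) A := Matrix.diagonal fun i => (d i : A) with hD
  set D' : Matrix (Fin N) (Fin N) A := Matrix.diagonal fun i => ((d i)⁻¹ : Aˣ) with hD'
  have hDu : IsUnit D := ⟨⟨D, D', by simp [hD, hD'], by simp [hD, hD']⟩, rfl⟩
  -- Entries do not commute, so no determinant is used: `D'M - 1` is strictly upper triangular, each
  -- power moves its support up one more diagonal, and the `N`-th power is zero.
  have hE : ∀ k : ℕ, ∀ i j : Fin N, (j : ℕ) < i + k → ((D' * M - 1) ^ k) i j = 0 := by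
    intro k
    induction k with
    | zero => intro i j hij; simp [Matrix.one_apply_ne (show i ≠ j by rintro rfl; omega)]
    | succ k ih =>
      intro i j hij
      rw [pow_succ, Matrix.mul_apply]
      refine Finset.sum_eq_zero fun m _ => ?_
      by_cases hm : (m : ℕ) < i + k
      · rw [ih i m hm, zero_mul]
      · have hjm : j ≤ m := by rw [Fin.le_def]; omega
        rw [Matrix.sub_apply, hD', Matrix.diagonal_mul]
        rcases hjm.lt_or_eq with hjm | rfl
        · rw [h _ _ hjm, Matrix.one_apply_ne hjm.ne']; simp
        · rw [← hd]; simp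
  have hnil : IsNilpotent (D' * M - 1) := ⟨N, by ext i j; rw [hE N i j (by omega)]; rfl⟩
  have := hnil.isUnit_one_add
  rw [add_sub_cancel] at this
  have h2 := hDu.mul this
  rwa [← mul_assoc, show D * D' = 1 by simp [hD, hD'], one_mul] at h2

theorem isUnit_of_lower {N : ℕ} (M : Matrix (Fin N) (Fin N) A) (h : ∀ i j, i < j → M i j = 0)
    (hd : ∀ i, IsUnit (M i i)) : IsUnit M := by
  have := isUnit_of_upper (M.submatrix Fin.rev Fin.rev)
    (fun i j hij => h _ _ (Fin.rev_lt_rev.2 hij)) (fun i => hd _)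
  obtain ⟨u, hu⟩ := this
  have h1 : M = (u : Matrix (Fin N) (Fin N) A).submatrix Fin.revPerm Fin.revPerm := by
    rw [hu]; ext; simp
  refine ⟨⟨M, ((u⁻¹ : _ˣ) : Matrix (Fin N) (Fin N) A).submatrix Fin.revPerm Fin.revPerm, ?_, ?_⟩,
    rfl⟩ <;> rw [h1, Matrix.submatrix_mul_equiv] <;> simp

/-- Power series with matrix coefficients as matrices of power series. -/
def matrixSeries (V : Type*) [Fintype V] [DecidableEq V] :
    (Matrix V V A)⟦X⟧ →+* Matrix V V A⟦X⟧ where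
  toFun F := Matrix.of fun i j => mk fun k => coeff k F i j
  map_one' := by
    ext i j k
    by_cases hij : i = j <;> by_cases hk : k = 0 <;>
      simp [coeff_one, Matrix.one_apply, hij, hk]
  map_zero' := by ext; simp
  map_add' F G := by ext; simp
  map_mul' F G := by
    ext i j k
    simp only [Matrix.of_apply, coeff_mk, Matrix.mul_apply, coeff_mul, Matrix.sum_apply, map_sum]
    rw [Finset.sum_comm]

/-- A matrix of series is a series with matrix coefficients, and a series is a unit as soon as its
constant coefficient is. -/
theorem isUnit_matrix_of_constantCoeff {V : Type*} [Fintype V] [DecidableEq V]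
    (M : Matrix V V A⟦X⟧) (h : IsUnit (M.map (constantCoeff (R := A)))) : IsUnit M := by
  have : M = matrixSeries V (mk fun k => Matrix.of fun i j => coeff k (M i j)) := by
    ext; simp [matrixSeries]
  rw [this]
  refine IsUnit.map _ (isUnit_iff_constantCoeff.2 ?_)
  convert h using 1
  ext i j
  rw [← coeff_zero_eq_constantCoeff_apply, coeff_mk, Matrix.of_apply, Matrix.map_apply,
    ← coeff_zero_eq_constantCoeff_apply]

end Units

/-! ### Families satisfying the defining relations, and reduction by one rank -/

section Families

open PowerSeries

/-- The parameter `z` of `R̄(uz/v)`: it is `1` for equal signs. -/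
def Mode.param {A : Type} [One A] (z : A) : Mode → A
  | .same _ => 1
  | .mixed => z

/-- A family of elements of an algebra that satisfies the defining relations of `U(R̄^{[n]})`, with
`q^{c/2}` and its inverse represented by `c` and `c'`. -/
structure IsRLLFamily (σ : Sgn) {τ : OType} {n : ℕ} {A : Type} [Ring A] [Algebra K A] (c c' : A)
    (l : Sgn → Fin (dim τ n) → Fin (dim τ n) → ℕ → A) : Prop where
  mul_inv : c * c' = 1
  inv_mul : c' * c = 1
  central (a : A) : Commute c a
  upper (i j : Fin (dim τ n)) (h : j < i) : l σ i j 0 = 0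
  lower (i j : Fin (dim τ n)) (h : j < i) : l σ.neg j i 0 = 0
  diag (ε : Sgn) (i : Fin (dim τ n)) : l ε i i 0 * l ε.neg i i 0 = 1
  rll (M : Mode) (r s : ℤ) (i k : Fin (dim τ n) × Fin (dim τ n)) :
    rllLeft l (M.param (c ^ 2)) M.fst M.snd r s i k =
      rllRight l (M.param (c' ^ 2)) M.fst M.snd r s i k

section Map

variable {τ : OType} {n : ℕ} {A B : Type} [Ring A] [Ring B] [Algebra K A] [Algebra K B]

theorem map_zcoeff (φ : A →ₐ[K] B) (l : Sgn → Fin (dim τ n) → Fin (dim τ n) → ℕ → A)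
    (ε : Sgn) (i j : Fin (dim τ n)) (r : ℤ) :
    φ (zcoeff ε (genMatrix l ε i j) r) =
      zcoeff ε (genMatrix (fun ε i j m => φ (l ε i j m)) ε i j) r := by
  cases ε <;> simp only [zcoeff, genMatrix] <;> split_ifs <;> simp

theorem map_rllLeft (φ : A →ₐ[K] B) (l : Sgn → Fin (dim τ n) → Fin (dim τ n) → ℕ → A)
    (t : A) (ε₁ ε₂ : Sgn) (r s : ℤ) (i k : Fin (dim τ n) × Fin (dim τ n)) :
    φ (rllLeft l t ε₁ ε₂ r s i k) =
      rllLeft (fun ε i j m => φ (l ε i j m)) (φ t) ε₁ ε₂ r s i k := by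
  simp only [rllLeft_apply, map_sum, map_mul, map_pow, map_zcoeff, AlgHom.commutes]

theorem map_rllRight (φ : A →ₐ[K] B) (l : Sgn → Fin (dim τ n) → Fin (dim τ n) → ℕ → A)
    (t : A) (ε₁ ε₂ : Sgn) (r s : ℤ) (i k : Fin (dim τ n) × Fin (dim τ n)) :
    φ (rllRight l t ε₁ ε₂ r s i k) =
      rllRight (fun ε i j m => φ (l ε i j m)) (φ t) ε₁ ε₂ r s i k := by
  simp only [rllRight_apply, map_sum, map_mul, map_pow, map_zcoeff, AlgHom.commutes]

end Map

variable (τ : OType) (σ : Sgn) (n : ℕ)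

theorem U.gen_commute (g : Gen (dim τ n)) :
    Commute (U.gen τ σ n .qc) (U.gen τ σ n g) := by
  have := RingQuot.mkAlgHom_rel K (Rel.qc_central (τ := τ) (σ := σ) (n := n) g)
  rw [map_mul, map_mul] at this
  exact this

theorem U.qc_commute (a : U τ σ n) : Commute (U.gen τ σ n .qc) a := by
  obtain ⟨x, rfl⟩ := RingQuot.mkAlgHom_surjective K (Rel τ σ n) a
  induction x using FreeAlgebra.induction with
  | grade0 r => rw [AlgHom.commutes]; exact Algebra.commutes' r _ |>.symm
  | grade1 g => exact U.gen_commute τ σ n g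
  | mul a b ha hb => rw [map_mul]; exact ha.mul_right hb
  | add a b ha hb => rw [map_add]; exact ha.add_right hb

theorem U.isRLLFamily : IsRLLFamily σ (U.gen τ σ n .qc) (U.gen τ σ n .qcInv)
    (fun ε i j m => U.gen τ σ n (.l ε i j m)) where
  mul_inv := by simpa [U.gen] using RingQuot.mkAlgHom_rel K (Rel.qc_mul (τ := τ) (σ := σ) (n := n))
  inv_mul := by simpa [U.gen] using RingQuot.mkAlgHom_rel K (Rel.qcInv_mul (τ := τ) (σ := σ) (n := n))
  central := U.qc_commute τ σ n
  upper i j h := by simpa [U.gen] using RingQuot.mkAlgHom_rel K (Rel.zero_upper (σ := σ) i j h)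
  lower i j h := by simpa [U.gen] using RingQuot.mkAlgHom_rel K (Rel.zero_lower (σ := σ) i j h)
  diag ε i := by simpa [U.gen] using RingQuot.mkAlgHom_rel K (Rel.diag (σ := σ) ε i)
  rll M r s i k := by
    rcases M with ε | _
    · have := RingQuot.mkAlgHom_rel K (Rel.rll_same (σ := σ) ε r s i k)
      rw [map_rllLeft, map_rllRight, map_one] at this
      exact this
    · have := RingQuot.mkAlgHom_rel K (Rel.rll_mixed (σ := σ) r s i k)
      rw [map_rllLeft, map_rllRight, map_pow, map_pow] at this
      exact this

variable {τ σ n}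

theorem IsRLLFamily.exists_lift {A : Type} [Ring A] [Algebra K A] {c c' : A}
    {l : Sgn → Fin (dim τ n) → Fin (dim τ n) → ℕ → A} (h : IsRLLFamily σ c c' l) :
    ∃ ψ : U τ σ n →ₐ[K] A, ψ (U.gen τ σ n .qc) = c ∧ ψ (U.gen τ σ n .qcInv) = c' ∧
      ∀ ε i j m, ψ (U.gen τ σ n (.l ε i j m)) = l ε i j m := by
  let f : Gen (dim τ n) → A := fun g => match g with
    | .qc => c
    | .qcInv => c'
    | .l ε i j m => l ε i j m
  have hf : ∀ ⦃x y⦄, Rel τ σ n x y → FreeAlgebra.lift K f x = FreeAlgebra.lift K f y := by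
    rintro x y (_ | _ | g | ⟨i, j, hij⟩ | ⟨i, j, hij⟩ | ⟨ε, i⟩ | ⟨ε, r, s, i, k⟩ | ⟨r, s, i, k⟩)
    · simpa [f] using h.mul_inv
    · simpa [f] using h.inv_mul
    · simpa [f] using (h.central (f g)).eq
    · simpa [f] using h.upper i j hij
    · simpa [f] using h.lower i j hij
    · simpa [f] using h.diag ε i
    · rw [map_rllLeft, map_rllRight, map_one]
      simpa [f, Mode.param, Mode.fst, Mode.snd] using h.rll (.same ε) r s i k
    · rw [map_rllLeft, map_rllRight, map_pow, map_pow]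
      simpa [f, Mode.param, Mode.fst, Mode.snd] using h.rll .mixed r s i k
  exact ⟨RingQuot.liftAlgHom K ⟨FreeAlgebra.lift K f, hf⟩, by simp [U.gen, f], by simp [U.gen, f],
    by simp [U.gen, f]⟩

theorem U.algHom_ext {A : Type} [Ring A] [Algebra K A] {f g : U τ σ n →ₐ[K] A}
    (h : ∀ x, f (U.gen τ σ n x) = g (U.gen τ σ n x)) : f = g :=
  RingQuot.ringQuot_ext' _ _ _ (FreeAlgebra.hom_ext (funext h))

theorem Sgn.neg_neg (ε : Sgn) : ε.neg.neg = ε := by cases ε <;> rfl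

theorem Sgn.eq_or_eq_neg (ε : Sgn) : ε = σ ∨ ε = σ.neg := by cases ε <;> cases σ <;> simp [Sgn.neg]

section Triangular

variable {A : Type} [Ring A] {c c' : A} {l : Sgn → Fin (dim τ n) → Fin (dim τ n) → ℕ → A}

theorem constantCoeff_genMatrix (ε : Sgn) (i j : Fin (dim τ n)) :
    constantCoeff (genMatrix l ε i j) = l ε i j 0 := by
  rw [← coeff_zero_eq_constantCoeff_apply, genMatrix, Matrix.of_apply, coeff_mk]

variable [Algebra K A]

theorem IsRLLFamily.isUnit_diag (h : IsRLLFamily σ c c' l) (ε : Sgn) (i : Fin (dim τ n)) :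
    IsUnit (l ε i i 0) :=
  ⟨⟨_, _, h.diag ε i, by simpa [Sgn.neg_neg] using h.diag ε.neg i⟩, rfl⟩

/-- An increasing choice of indices keeps the zero modes triangular, upper for `ε = σ` and lower for
the opposite sign. -/
theorem IsRLLFamily.isUnit_of_constantCoeff (h : IsRLLFamily σ c c' l) (ε : Sgn) {N : ℕ}
    {f : Fin N → Fin (dim τ n)} (hf : StrictMono f) (M : Matrix (Fin N) (Fin N) A⟦X⟧)
    (hM : ∀ i j, constantCoeff (M i j) = l ε (f i) (f j) 0) : IsUnit M := by
  refine isUnit_matrix_of_constantCoeff _ ?_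
  rcases Sgn.eq_or_eq_neg (σ := σ) ε with rfl | rfl
  · refine isUnit_of_upper _ (fun i j hij => ?_) (fun i => ?_)
    · rw [Matrix.map_apply, hM]; exact h.upper _ _ (hf hij)
    · rw [Matrix.map_apply, hM]; exact h.isUnit_diag _ _
  · refine isUnit_of_lower _ (fun i j hij => ?_) (fun i => ?_)
    · rw [Matrix.map_apply, hM]; exact h.lower _ _ (hf hij)
    · rw [Matrix.map_apply, hM]; exact h.isUnit_diag _ _

end Triangular

section Step

variable {p : ℕ} {A : Type} [Ring A] {c c' : A}
    {l : Sgn → Fin (dim τ (p + 1)) → Fin (dim τ (p + 1)) → ℕ → A}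

/-- The coefficients of the Schur complements of the top left entries of the matrices `𝓛^±(u)`. -/
def reduced (l : Sgn → Fin (dim τ (p + 1)) → Fin (dim τ (p + 1)) → ℕ → A) (ε : Sgn)
    (i j : Fin (dim τ p)) (m : ℕ) : A :=
  coeff m (schurMid (genMatrix l ε) (Ring.inverse (genMatrix l ε (top τ p) (top τ p))) i j)

theorem genMatrix_reduced (ε : Sgn) : genMatrix (reduced l) ε =
    schurMid (genMatrix l ε) (Ring.inverse (genMatrix l ε (top τ p) (top τ p))) := by
  ext i j m
  simp [genMatrix, reduced]

variable [Algebra K A]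

theorem top_lt_mid (i : Fin (dim τ p)) : top τ p < mid τ p i := by
  rw [Fin.lt_def]; simp [top, mid]

/-- In the zero mode of the correction term one of the two outer factors vanishes by triangularity.
-/
theorem IsRLLFamily.reduced_zero (h : IsRLLFamily σ c c' l) (ε : Sgn) (i j : Fin (dim τ p)) :
    reduced l ε i j 0 = l ε (mid τ p i) (mid τ p j) 0 := by
  rw [reduced, coeff_zero_eq_constantCoeff_apply, schurMid, Matrix.of_apply, schur, map_sub,
    map_mul, map_mul, constantCoeff_genMatrix, constantCoeff_genMatrix, constantCoeff_genMatrix, sub_eq_self]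
  rcases Sgn.eq_or_eq_neg (σ := σ) ε with rfl | rfl
  · rw [h.upper _ _ (top_lt_mid i), zero_mul, zero_mul]
  · rw [h.lower _ _ (top_lt_mid j), mul_zero]

theorem IsRLLFamily.isUnit_top (h : IsRLLFamily σ c c' l) (ε : Sgn) :
    IsUnit (genMatrix l ε (top τ p) (top τ p)) := by
  rw [isUnit_iff_constantCoeff, constantCoeff_genMatrix]
  exact h.isUnit_diag _ _

theorem mid_strictMono : StrictMono (mid τ p) := fun _ _ h => mid_lt.2 h

theorem IsRLLFamily.isUnit_reduced (h : IsRLLFamily σ c c' l) (ε : Sgn) :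
    IsUnit (genMatrix (reduced l) ε) :=
  h.isUnit_of_constantCoeff ε mid_strictMono _ fun i j => by
    rw [constantCoeff_genMatrix, h.reduced_zero]

theorem schurMid_map {S S' : Type*} [Ring S] [Ring S'] (φ : S →+* S')
    (T : Matrix (Fin (dim τ (p + 1))) (Fin (dim τ (p + 1))) S) (a : S) :
    schurMid (T.map φ) (φ a) = (schurMid T a).map φ := by
  ext i j
  simp [schurMid, schur]

/-- The Schur complements of the top left entries satisfy the defining relations in rank `p`. -/
theorem IsRLLFamily.reduced (h : IsRLLFamily σ c c' l) : IsRLLFamily σ c c' (reduced l) where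
  mul_inv := h.mul_inv
  inv_mul := h.inv_mul
  central := h.central
  upper i j hij := by rw [h.reduced_zero]; exact h.upper _ _ (mid_lt.2 hij)
  lower i j hij := by rw [h.reduced_zero]; exact h.lower _ _ (mid_lt.2 hij)
  diag ε i := by rw [h.reduced_zero, h.reduced_zero]; exact h.diag _ _
  rll M := by
    have hc' : ∀ a, Commute c' a := fun a => by
      have := congrArg (fun x => c' * x * c') (h.central a).eq
      simp only [mul_assoc, h.mul_inv, mul_one] at this
      rw [← mul_assoc, ← mul_assoc, h.inv_mul, one_mul] at this
      exact this.symm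
    have ht : ∀ a, Commute (M.param (c ^ 2)) a := fun a => by
      cases M
      · exact Commute.one_left a
      · exact (h.central a).pow_left 2
    have ht' : ∀ a, Commute (M.param (c' ^ 2)) a := fun a => by
      cases M
      · exact Commute.one_left a
      · exact (hc' a).pow_left 2
    have hM : ∀ z : A, ∀ ε, M = .same ε → M.param z = 1 := by rintro z ε rfl; rfl
    rw [rll_iff _ M ht ht' (hM _) (hM _)]
    have H := (rll_iff l M ht ht' (hM _) (hM _)).1 (h.rll M)
    obtain ⟨G, hG⟩ := h.isUnit_reduced M.snd
    have hGG : genMatrix (QAff.reduced l) M.snd * (G⁻¹ : _ˣ) = 1 := by rw [← hG]; simp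
    have hGG' : (G⁻¹ : _ˣ) * genMatrix (QAff.reduced l) M.snd = 1 := by rw [← hG]; simp
    have hu := Ring.mul_inverse_cancel _ (h.isUnit_top M.fst)
    have hu' := Ring.inverse_mul_cancel _ (h.isUnit_top M.fst)
    have hv := Ring.mul_inverse_cancel _ (h.isUnit_top M.snd)
    have hv' := Ring.inverse_mul_cancel _ (h.isUnit_top M.snd)
    rw [genMatrix_reduced] at hGG hGG' ⊢
    rw [genMatrix_reduced]
    have hgr : ∀ φ : K⟦X⟧ →+* A⟦X⟧⟦X⟧, IsGraded ((Rbar τ (p + 1)).map φ) :=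
      fun φ i j k l hijkl => by rw [Matrix.map_apply, Rbar_deg _ _ _ _ _ _ hijkl, map_zero]
    have hr := Rbar_pivot_inverse τ p
    ext1 ⟨i, j⟩ ⟨m, k⟩
    -- All inverses are images under `homU`, `homV`, `homR` of inverses found in one variable. The
    -- two pivots come from the same scalar series and differ only in the central parameter.
    have := schur_exchange (A := M.homU (Ring.inverse (genMatrix l M.fst (top τ p) (top τ p))))
      (A' := M.homV (Ring.inverse (genMatrix l M.snd (top τ p) (top τ p))))
      (G := ((G⁻¹ : _ˣ) : Matrix (Fin (dim τ p)) (Fin (dim τ p)) A⟦X⟧).map M.homV)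
      (hgr _) (hgr _) H
      (by rw [Matrix.map_apply, ← map_mul, hu, map_one])
      (by rw [Matrix.map_apply, ← map_mul, hu', map_one])
      (by rw [Matrix.map_apply, ← map_mul, hv, map_one])
      (by rw [Matrix.map_apply, ← map_mul, hv', map_one])
      (by rw [schurMid_map, ← Matrix.map_mul, hGG, Matrix.map_one _ (map_zero _) (map_one _)])
      (by rw [schurMid_map, ← Matrix.map_mul, hGG', Matrix.map_one _ (map_zero _) (map_one _)])
      (ra := M.homR _ ht _) (rb := M.homR _ ht' _)
      (by rw [Matrix.map_apply, ← map_mul, mul_comm, hr, map_one])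
      (by rw [Matrix.map_apply, ← map_mul, hr, map_one]) i j m k
    -- Ring homomorphisms preserve Schur complements, so the coefficients become the images of the
    -- entries of `R̄` in rank `p`.
    simp only [schurMid_map, Matrix.map_apply, ← map_mul, ← map_sub, ← Rbar_schur τ p _ _ _ _ _ hr]
      at this
    simpa only [Matrix.mul_apply, Fintype.sum_prod_type, Matrix.map_apply, prodLR, prodRL,
      Matrix.of_apply, map_mul] using this

end Step
end Families

/-! ### Quasideterminants by row elimination -/

section Quasideterminants

variable {S : Type} [Ring S] {V : Type*} {m : ℕ} (M : Matrix V V S) (f : Fin m → V)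

theorem exists_row_coefficients (hu : IsUnit (M.submatrix f f)) (v : Fin m → S) :
    ∃ y : Fin m → S, ∀ a, v a = ∑ b, y b * M (f b) (f a) := by
  refine ⟨Matrix.vecMul v (Ring.inverse (M.submatrix f f)), fun a => ?_⟩
  have : Matrix.vecMul (Matrix.vecMul v (Ring.inverse (M.submatrix f f))) (M.submatrix f f) = v := by
    rw [Matrix.vecMul_vecMul, Ring.inverse_mul_cancel _ hu, Matrix.vecMul_one]
  exact (congrFun this a).symm

/-- The linear system for `y` has a unique solution, so any solution found by hand computes the
quasideterminant and no block inverse needs to be expanded. -/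
theorem quasidet_snoc (hu : IsUnit (M.submatrix f f)) (i j : V) (y : Fin m → S)
    (hy : ∀ a, M i (f a) = ∑ b, y b * M (f b) (f a)) :
    quasidet (M.submatrix (Fin.snoc (α := fun _ => V) f i) (Fin.snoc (α := fun _ => V) f j))
      (Fin.last m) (Fin.last m) = M i j - ∑ b, y b * M (f b) j := by
  have h1 : (M.submatrix (Fin.snoc (α := fun _ => V) f i)
      (Fin.snoc (α := fun _ => V) f j)).submatrix (Fin.last m).succAbove (Fin.last m).succAbove =
      M.submatrix f f := by
    ext a b; simp
  have h2 : Matrix.vecMul (fun a => M i (f a)) (Ring.inverse (M.submatrix f f)) = y := by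
    have : (fun a => M i (f a)) = Matrix.vecMul y (M.submatrix f f) := funext hy
    rw [this, Matrix.vecMul_vecMul, Ring.mul_inverse_cancel _ hu, Matrix.vecMul_one]
  rw [quasidet, h1, Finset.sum_comm]
  simp only [Matrix.submatrix_apply, Fin.succAbove_last, Fin.snoc_castSucc, Fin.snoc_last, ← Finset.sum_mul]
  congr 1
  refine Finset.sum_congr rfl fun b _ => ?_
  rw [← h2]
  rfl

end Quasideterminants

/-! ### The homomorphisms: existence, uniqueness and composition -/

section Reductions

open PowerSeries

variable {τ : OType} {σ : Sgn}

theorem isUnit_firstBlock {m n p : ℕ} (h : p + m = n) (ε : Sgn) :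
    IsUnit ((Lser τ σ n ε).submatrix (firstIdx τ h) (firstIdx τ h)) :=
  (U.isRLLFamily τ σ n).isUnit_of_constantCoeff ε (f := firstIdx τ h) (fun _ _ hab => hab) _
    fun a b => constantCoeff_genMatrix (l := fun ε i j m => U.gen τ σ n (.l ε i j m)) ε
      (firstIdx τ h a) (firstIdx τ h b)

theorem IsReduction.unique {m n p : ℕ} {h : p + m = n} {ψ ψ' : U τ σ p →ₐ[K] U τ σ n}
    (hψ : IsReduction h ψ) (hψ' : IsReduction h ψ') : ψ = ψ' := by
  refine U.algHom_ext fun x => ?_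
  rcases x with _ | _ | ⟨ε, i, j, k⟩
  · rw [hψ.map_qc, hψ'.map_qc]
  · rw [hψ.map_qcInv, hψ'.map_qcInv]
  · have := congrArg (coeff k) ((hψ.map_l ε i j).trans (hψ'.map_l ε i j).symm)
    simpa [Lser] using this

theorem exists_isReduction_one {n p : ℕ} (h : p + 1 = n) :
    ∃ ψ : U τ σ p →ₐ[K] U τ σ n, IsReduction h ψ := by
  subst h
  obtain ⟨ψ, h1, h2, h3⟩ := (U.isRLLFamily τ σ (p + 1)).reduced.exists_lift
  refine ⟨ψ, h1, h2, fun ε i j => ?_⟩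
  have hf : firstIdx τ (rfl : p + 1 = p + 1) = fun _ => top τ p := by
    ext a; simp [firstIdx, top]
  have hs : ∀ i, shiftIdx τ (rfl : p + 1 = p + 1) i = mid τ p i := fun i => by
    simp [shiftIdx, mid, add_comm]
  have hu : IsUnit (Lser τ σ (p + 1) ε (top τ p) (top τ p)) :=
    (U.isRLLFamily τ σ (p + 1)).isUnit_top ε
  rw [bordered, bordered, quasidet_snoc _ _ (isUnit_firstBlock rfl ε) _ _
    (fun _ => Lser τ σ (p + 1) ε (mid τ p i) (top τ p) *
      Ring.inverse (Lser τ σ (p + 1) ε (top τ p) (top τ p)))]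
  · ext k
    rw [coeff_map, Lser, Matrix.of_apply, coeff_mk]
    refine (h3 ε i j k).trans ?_
    rw [hs, hs, hf, Fin.sum_univ_one]
    rfl
  · intro a
    rw [hs, hf, Fin.sum_univ_one]
    beta_reduce
    rw [mul_assoc, Ring.inverse_mul_cancel _ hu, mul_one]

/-- Two successive row eliminations subtract from row `i` one combination of the first `l + m` rows,
and its coefficients solve the system that characterises the large quasideterminant. -/
theorem IsReduction.comp {n l m r p : ℕ} {hm : p + m = r} {hl : r + l = n} (hlm : p + (l + m) = n)
    {ψm : U τ σ p →ₐ[K] U τ σ r} {ψl : U τ σ r →ₐ[K] U τ σ n}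
    (Hm : IsReduction hm ψm) (Hl : IsReduction hl ψl) : IsReduction hlm (ψl.comp ψm) where
  map_qc := by rw [AlgHom.comp_apply, Hm.map_qc, Hl.map_qc]
  map_qcInv := by rw [AlgHom.comp_apply, Hm.map_qcInv, Hl.map_qcInv]
  map_l ε i j := by
    have f1 : ∀ a, firstIdx τ hlm (Fin.castAdd m a) = firstIdx τ hl a := fun a => rfl
    have f2 : ∀ c, firstIdx τ hlm (Fin.natAdd l c) = shiftIdx τ hl (firstIdx τ hm c) := fun c => rfl
    have f3 : ∀ i, shiftIdx τ hlm i = shiftIdx τ hl (shiftIdx τ hm i) := fun i =>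
      Fin.ext (add_assoc l m i)
    choose y hy using fun i' => exists_row_coefficients (Lser τ σ n ε) (firstIdx τ hl)
      (isUnit_firstBlock hl ε) (fun a => Lser τ σ n ε (shiftIdx τ hl i') (firstIdx τ hl a))
    obtain ⟨z, hz⟩ := exists_row_coefficients (Lser τ σ r ε) (firstIdx τ hm)
      (isUnit_firstBlock hm ε) (fun a => Lser τ σ r ε (shiftIdx τ hm i) (firstIdx τ hm a))
    set φ := PowerSeries.map (ψl : U τ σ r →+* U τ σ n)
    have hS : ∀ i' j', φ (Lser τ σ r ε i' j') = Lser τ σ n ε (shiftIdx τ hl i') (shiftIdx τ hl j') -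
        ∑ b, y i' b * Lser τ σ n ε (firstIdx τ hl b) (shiftIdx τ hl j') := fun i' j' => by
      rw [← quasidet_snoc _ _ (isUnit_firstBlock hl ε) _ _ _ (hy i')]
      exact Hl.map_l ε i' j'
    have e1 : PowerSeries.map (ψl.comp ψm : U τ σ p →+* U τ σ n) (Lser τ σ p ε i j) =
        φ (PowerSeries.map (ψm : U τ σ p →+* U τ σ r) (Lser τ σ p ε i j)) := by
      ext k; simp [φ]
    rw [e1, Hm.map_l, bordered, bordered, quasidet_snoc _ _ (isUnit_firstBlock hm ε) _ _ z hz,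
      bordered, bordered, quasidet_snoc _ _ (isUnit_firstBlock hlm ε) _ _
      -- The second step subtracts `φ (z c)` times the reduced row `l + c`, which is that row minus
      -- the combination `y` of the first `l` rows. Collecting terms by rows gives these
      -- coefficients.
      (Fin.addCases (fun b => y (shiftIdx τ hm i) b - ∑ c, φ (z c) * y (firstIdx τ hm c) b)
        (fun c => φ (z c)))]
    · simp only [map_sub, map_sum, map_mul, hS, Fin.sum_univ_add, f1, f2, f3, Fin.addCases_left,
        Fin.addCases_right, sub_mul, mul_sub, Finset.sum_sub_distrib, Finset.sum_mul,
        Finset.mul_sum, mul_assoc]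
      rw [Finset.sum_comm (s := (Finset.univ : Finset (Fin m)))]
      abel
    · intro a
      refine Fin.addCases (fun a => ?_) (fun c => ?_) a
      · simp only [Fin.sum_univ_add, f1, f2, f3, Fin.addCases_left, Fin.addCases_right, sub_mul,
          Finset.sum_sub_distrib, Finset.sum_mul, mul_assoc]
        rw [Finset.sum_comm]
        simp only [← Finset.mul_sum, ← hy]
        abel
      -- In the columns `l + c` the system is the image under `φ` of the one solved by `z`; in the
      -- first `l` columns it followed from the equations for `y` alone.
      · have := congrArg φ (hz c)
        simp only [map_sum, map_mul, hS] at this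
        simp only [Fin.sum_univ_add, f1, f2, f3, Fin.addCases_left, Fin.addCases_right]
        rw [sub_eq_iff_eq_add] at this
        rw [this]
        simp only [sub_mul, mul_sub, Finset.sum_sub_distrib, Finset.sum_mul,
          Finset.mul_sum, mul_assoc]
        rw [Finset.sum_comm (s := (Finset.univ : Finset (Fin m)))]
        abel

theorem exists_isReduction (m : ℕ) (hm : 0 < m) : ∀ {n p : ℕ} (h : p + m = n),
    ∃ ψ : U τ σ p →ₐ[K] U τ σ n, IsReduction h ψ := by
  induction m, hm using Nat.le_induction with
  | base => exact fun h => exists_isReduction_one h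
  | succ k _ ih =>
    intro n p h
    -- The reduction by `k + 1` factors through rank `p + 1`: one step from `p`, then `k` steps up
    -- to `n`.
    obtain ⟨ψl, hl⟩ := ih (show p + 1 + k = n by omega)
    obtain ⟨ψm, hm⟩ := exists_isReduction_one (τ := τ) (σ := σ) (rfl : p + 1 = p + 1)
    exact ⟨ψl.comp ψm, hm.comp h hl⟩

end Reductions
end QAff
end

theorem mainTheorem7 (τ : QAff.OType) (σ : QAff.Sgn) :
    (∀ (n m p : ℕ) (h : p + m = n), 0 < m → 0 < p →
      (∀ ε : QAff.Sgn,
        IsUnit ((QAff.Lser τ σ n ε).submatrix (QAff.firstIdx τ h) (QAff.firstIdx τ h))) ∧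
      ∃! ψ : QAff.U τ σ p →ₐ[QAff.K] QAff.U τ σ n, QAff.IsReduction h ψ) ∧
    (∀ (n l m r p : ℕ) (hm : p + m = r) (hl : r + l = n) (hlm : p + (l + m) = n),
      0 < l → 0 < m → 0 < p →
      ∀ (ψm : QAff.U τ σ p →ₐ[QAff.K] QAff.U τ σ r)
        (ψl : QAff.U τ σ r →ₐ[QAff.K] QAff.U τ σ n)
        (ψlm : QAff.U τ σ p →ₐ[QAff.K] QAff.U τ σ n),
        QAff.IsReduction hm ψm → QAff.IsReduction hl ψl → QAff.IsReduction hlm ψlm →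
        ψl.comp ψm = ψlm) := by
  refine ⟨fun n m p h hm _ => ⟨fun ε => QAff.isUnit_firstBlock h ε, ?_⟩,
    fun n l m r p hm hl hlm _ _ _ ψm ψl ψlm Hm Hl Hlm => (Hm.comp hlm Hl).unique Hlm⟩
  obtain ⟨ψ, hψ⟩ := QAff.exists_isReduction (τ := τ) (σ := σ) m hm h
  exact ⟨ψ, hψ, fun ψ' hψ' => hψ'.unique hψ⟩
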